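/- Let $n\ge 3$, read indices modulo $n$, and let $\varphi:\mathbb R^{2n}\to\mathbb R^{2n}$ be the pentagram automaton, which sends $(x_i,y_i)_{i}$ to $$\bigl(x_i+\max(0,x_{i-1}+y_{i-1})-\max(0,x_{i+1}+y_{i+1}),\ \ y_{i+1}+\max(0,x_{i+2}+y_{i+2})-\max(0,x_i+y_i)\bigr)_{i}.$$ Call a pair $(S,J)$ of subsets of $\mathbb Z/n$ admissible if $j\notin\{i-2,i-1,i+1,i+2\}$ for all distinct $i,j\in S$, $j\notin\{i-1,i,i+1,i+2\}$ for all $i\in S$, $j\in J$, and $i+1\notin J$ for all $i\in J$. For $1\le k\le[\frac n2]$ put $$\tilde O_k(x,y)=\max_{(S,J)}\Bigl(\sum_{i\in S}(x_i+y_i+x_{i+1})+\sum_{j\in J}x_j\Bigr),\qquad \tilde E_k(x,y)=\max_{(S,J)}\Bigl(\sum_{i\in S}(y_i+x_{i+1}+y_{i+1})+\sum_{j\in J}y_j\Bigr),$$ both maxima being over all admissible pairs with $|S|+|J|=k$ (these are the max-plus versions of the Ovsienko–Schwartz–Tabachnikov invariants $O_k$, $E_k$). For $q\in\mathbb R^{2n}$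 let $P(q)$ be the set of all points of $\mathbb R^{2n}$ at which the $2[\frac n2]+2$ functions $\sum_i x_i$, $\sum_i y_i$, $\tilde O_k$, $\tilde E_k$ $(1\le k\le[\frac n2])$ take the same values as at $q$. Then for every $q\in\mathbb R^{2n}$ the whole orbit $\{\varphi^l(q):l\ge 0\}$ lies in $P(q)$; and for generic $q$, namely for all $q$ outside a finite union of proper affine subspaces of $\mathbb R^{2n}$ depending only on $n$, the set $P(q)$ is a polytope of dimension $2[\frac{n+1}{2}]-2$, i.e. a nonempty finite union of (compact) convex polytopes all of dimension $2[\frac{n+1}{2}]-2$. -/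

import Mathlib

namespace Pentagram

noncomputable section

/-- The phase space `ℝ^{2n}`: a point is `q = (x, y)` with `x = q.1` and `y = q.2`,
the indices being read modulo `n`. -/
abbrev Phase (n : ℕ) : Type := (ZMod n → ℝ) × (ZMod n → ℝ)

/-- The pentagram automaton. -/
def automaton {n : ℕ} (q : Phase n) : Phase n :=
  (fun i => q.1 i + max 0 (q.1 (i - 1) + q.2 (i - 1)) - max 0 (q.1 (i + 1) + q.2 (i + 1)),
   fun i => q.2 (i + 1) + max 0 (q.1 (i + 2) + q.2 (i + 2)) - max 0 (q.1 i + q.2 i))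

/-- A square-free product of "long" factors (indexed by `long`) and "short" factors (indexed by
`short`). For the invariants `O_k` the long factors are `Z_i = z_i w_i z_{i+1}` and the short ones
are `z_j`; for the invariants `E_k` the long factors are `W_i = w_i z_{i+1} w_{i+1}` and the short
ones are `w_j`. -/
structure Mon (n : ℕ) where
  long : Finset (ZMod n)
  short : Finset (ZMod n)

/-- No two factors are consecutive. Two long factors `i`, `j` are consecutive if
`j ∈ {i-2, i-1, i, i+1, i+2}`, a long factor `i` and a short factor `j` if
`j ∈ {i-1, i, i+1, i+2}`, and the short factors `i`, `i+1` are consecutive. -/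
def Mon.Admissible {n : ℕ} (m : Mon n) : Prop :=
  (∀ i ∈ m.long, ∀ j ∈ m.long, i ≠ j → j ∉ ({i - 2, i - 1, i, i + 1, i + 2} : Set (ZMod n))) ∧
  (∀ i ∈ m.long, ∀ j ∈ m.short, j ∉ ({i - 1, i, i + 1, i + 2} : Set (ZMod n))) ∧
  (∀ i ∈ m.short, i + 1 ∉ m.short)

/-- The number of factors. -/
def Mon.length {n : ℕ} (m : Mon n) : ℕ := m.long.card + m.short.card

/-- The tropicalization of the monomial, read as a monomial of `O`-type. -/
def Mon.valO {n : ℕ} (m : Mon n) (q : Phase n) : ℝ :=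
  ∑ i ∈ m.long, (q.1 i + q.2 i + q.1 (i + 1)) + ∑ j ∈ m.short, q.1 j

/-- The tropicalization of the monomial, read as a monomial of `E`-type. -/
def Mon.valE {n : ℕ} (m : Mon n) (q : Phase n) : ℝ :=
  ∑ i ∈ m.long, (q.2 i + q.1 (i + 1) + q.2 (i + 1)) + ∑ j ∈ m.short, q.2 j

/-- The max-plus version of `O_k`: the maximum over all admissible monomials with `k` factors
(a finite set, nonempty for `k ≤ n / 2`). -/
def tropO {n : ℕ} (k : ℕ) (q : Phase n) : ℝ :=
  ⨆ m : {m : Mon n // m.Admissible ∧ m.length = k}, m.1.valO q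

/-- The max-plus version of `E_k`. -/
def tropE {n : ℕ} (k : ℕ) (q : Phase n) : ℝ :=
  ⨆ m : {m : Mon n // m.Admissible ∧ m.length = k}, m.1.valE q

/-- The common level set through `q` of the `2 [n/2] + 2` tropical invariants: the max-plus
versions `∑ x_i`, `∑ y_i` of `O_n`, `E_n`, and those of `O_k`, `E_k` for `1 ≤ k ≤ [n/2]`. -/
def levelSet {n : ℕ} [NeZero n] (q : Phase n) : Set (Phase n) :=
  {p | ∑ i, p.1 i = ∑ i, q.1 i ∧ ∑ i, p.2 i = ∑ i, q.2 i ∧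
    ∀ k ∈ Finset.Icc 1 (n / 2), tropO k p = tropO k q ∧ tropE k p = tropE k q}

/-- A `d`-dimensional (not necessarily convex) compact polytope: a nonempty finite union of convex
polytopes, all of dimension `d`. -/
def IsPolytopeOfDim {V : Type*} [AddCommGroup V] [Module ℝ V] (P : Set V) (d : ℕ) : Prop :=
  ∃ C : Set (Finset V), C.Finite ∧ C.Nonempty ∧
    (∀ s ∈ C, s.Nonempty ∧ Module.finrank ℝ (vectorSpan ℝ (s : Set V)) = d) ∧
    P = ⋃ s ∈ C, convexHull ℝ (s : Set V)

end

end Pentagram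

/-!
*Invariance.* An admissible monomial assigns a state to every site of `ZMod n`: empty, a short
factor, or the first or the second half of a long one. Group the monomials of `O`-type by the set
`I` of last sites of their factors: the maximum over a group is a sum of local terms, and it agrees
with the maximum, after one step of the automaton, over the monomials whose factors have first
sites `I`. Maximising over `I` shows that `tropO k` is invariant; `tropE k` follows by the
reflection of the cycle.

*Dimension.* At a generic point every invariant agrees nearby with one linear form, the exponent
vector of its unique optimal monomial, and these vectors pairwise commute for the log-canonical
bracket. They are linearly independent at a base point, and independence propagates along generic
segments: at a wall two competing monomials differ by a vector `g`, and a loss of independence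
would put `(g, 0)` in the span of the pairs of exponent vectors on the two sides of the wall, which
is refuted either by a bracket or by the uniqueness of the optimal monomials. A level set is a
union of bounded polyhedra, one for each choice of optimal monomials. Off finitely many proper
subspaces every nonempty piece contains a point at which all nontrivial inequalities are strict, so
that its direction is the common kernel of `2 [n/2] + 2` independent linear forms.
-/

namespace Pentagram

/-- The two families of invariants, `O_k` and `E_k`. -/
inductive Kind
  | O | E
  deriving DecidableEq

instance : Fintype Kind := ⟨{.O, .E}, fun τ => by cases τ <;> decide⟩

/-- Exchange of the two families. -/
def Kind.swap : Kind → Kind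
  | O => E
  | E => O

/-- The state of a site of the cycle `ZMod n` in an admissible monomial: empty, occupied by a short
factor `j`, or by the first (`i`) or second (`i + 1`) site of a long factor `i`. -/
inductive Cell
  | empty | short | head | tail
  deriving DecidableEq

instance : Fintype Cell := ⟨{.empty, .short, .head, .tail}, fun a => by cases a <;> decide⟩

namespace Cell

/-- The states that may stand on two neighbouring sites. -/
def CanPrecede (a b : Cell) : Prop :=
  match a with
  | empty => b ≠ tail
  | short => b = empty
  | head => b = tail
  | tail => b = empty

instance : DecidableRel CanPrecede := fun a b => by
  cases a <;> simp only [CanPrecede] <;> infer_instance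

/-- The indicator of the occupied states. -/
def occInd : Cell → ℤ
  | empty => 0
  | short => 1
  | head => 1
  | tail => 1

/-- The indicator of the state `head`. -/
def headInd : Cell → ℤ
  | empty => 0
  | short => 0
  | head => 1
  | tail => 0

/-- The indicator of the state `tail`. -/
def tailInd : Cell → ℤ
  | empty => 0
  | short => 0
  | head => 0
  | tail => 1

/-- The indicator of the first sites of factors; its sum over the cycle counts the factors. -/
def startInd : Cell → ℤ
  | empty => 0
  | short => 1
  | head => 1
  | tail => 0

/-- Exchange of heads and tails, the effect of reversing the cycle. -/
def reverse : Cell → Cell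
  | empty => empty
  | short => short
  | head => tail
  | tail => head

/-- The exponent of `x_i` contributed by the state of the site `i`. -/
def expX : Kind → Cell → ℤ
  | .O => occInd
  | .E => tailInd

/-- The exponent of `y_i` contributed by the state of the site `i`. -/
def expY : Kind → Cell → ℤ
  | .O => headInd
  | .E => occInd

theorem CanPrecede.eq_tail_iff {a b : Cell} : CanPrecede a b → (b = tail ↔ a = head) := by
  revert a b; decide

theorem CanPrecede.left_eq_empty {a b : Cell} : CanPrecede a b → b ≠ empty → b ≠ tail →
    a = empty := by
  revert a b; decide

theorem CanPrecede.right_eq_empty {a b : Cell} : CanPrecede a b → a ≠ empty → a ≠ head →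
    b = empty := by
  revert a b; decide

theorem CanPrecede.reverse {a b c : Cell} : CanPrecede a b → CanPrecede b c →
    CanPrecede c.reverse b.reverse := by
  revert a b c; decide

theorem reverse_reverse : ∀ a : Cell, a.reverse.reverse = a := by decide

theorem reverse_eq_short_iff : ∀ {a : Cell}, a.reverse = short ↔ a = short := by decide

theorem reverse_eq_head_iff : ∀ {a : Cell}, a.reverse = head ↔ a = tail := by decide

theorem expX_swap_reverse : ∀ (τ : Kind) (a : Cell), expX τ.swap a.reverse = expY τ a := by decide

theorem expY_swap_reverse : ∀ (τ : Kind) (a : Cell), expY τ.swap a.reverse = expX τ a := by decide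

theorem startInd_nonneg : ∀ a : Cell, 0 ≤ startInd a := by decide

theorem startInd_eq : ∀ a : Cell,
    startInd a = (if a = short then 1 else 0) + if a = head then 1 else 0 := by decide

theorem CanPrecede.startInd_add_startInd_le {a b : Cell} : CanPrecede a b →
    startInd a + startInd b ≤ 1 := by
  revert a b; decide

end Cell

open Cell

variable {n : ℕ}

/-- The encoding of an admissible monomial by the states of the sites. -/
def IsConfig (S : ZMod n → Cell) : Prop := ∀ i, CanPrecede (S i) (S (i + 1))

theorem IsConfig.pred {S : ZMod n → Cell} (hS : IsConfig S) (i : ZMod n) :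
    CanPrecede (S (i - 1)) (S i) := by
  simpa using hS (i - 1)

/-- The exponent vector of the monomial of a configuration, read as a monomial of kind `τ`. -/
def exponent (τ : Kind) (S : ZMod n → Cell) : Phase n :=
  (fun i => (expX τ (S i) : ℝ), fun i => (expY τ (S i) : ℝ))

/-! ### Sums over the cycle -/

variable [NeZero n]

theorem sum_add_right {M : Type*} [AddCommMonoid M] (g : ZMod n → M) (c : ZMod n) :
    ∑ i, g (i + c) = ∑ i, g i :=
  Equiv.sum_comp (Equiv.addRight c) g

theorem sum_neg_index {M : Type*} [AddCommMonoid M] (g : ZMod n → M) :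
    ∑ i, g (-i) = ∑ i, g i :=
  Equiv.sum_comp (Equiv.neg _) g

theorem sum_eq_sum_range {M : Type*} [AddCommMonoid M] (g : ZMod n → M) (i : ZMod n) :
    ∑ j, g j = ∑ t ∈ Finset.range n, g (i + t) := by
  rw [← sum_add_right g i]
  symm
  refine Finset.sum_bij (fun t _ => (t : ZMod n)) (fun _ _ => Finset.mem_univ _) ?_ ?_ ?_
  · intro a ha b hb hab
    simpa [ZMod.val_natCast, Nat.mod_eq_of_lt (Finset.mem_range.1 ha),
      Nat.mod_eq_of_lt (Finset.mem_range.1 hb)] using congrArg ZMod.val hab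
  · exact fun b _ => ⟨b.val, Finset.mem_range.2 (ZMod.val_lt b), by simp⟩
  · exact fun a _ => by rw [add_comm]

theorem val_add_one_cases (i : ZMod n) :
    ((i + 1).val = i.val + 1 ∧ i.val + 1 < n) ∨ ((i + 1).val = 0 ∧ i.val + 1 = n) := by
  have h : (i + 1).val = (i.val + 1) % n := by
    rw [← ZMod.val_natCast, Nat.cast_add, ZMod.natCast_zmod_val, Nat.cast_one]
  rcases (show i.val + 1 ≤ n from ZMod.val_lt i).lt_or_eq with hlt | heq
  · exact .inl ⟨by rw [h, Nat.mod_eq_of_lt hlt], hlt⟩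
  · exact .inr ⟨by rw [h, heq, Nat.mod_self], heq⟩

/-- The standard scalar product of the phase space. -/
noncomputable def dot : Phase n →ₗ[ℝ] Phase n →ₗ[ℝ] ℝ :=
  (dotProductBilin ℝ ℝ).compl₁₂ (LinearMap.fst ℝ _ _) (LinearMap.fst ℝ _ _) +
    (dotProductBilin ℝ ℝ).compl₁₂ (LinearMap.snd ℝ _ _) (LinearMap.snd ℝ _ _)

theorem dot_apply (v q : Phase n) : dot v q = ∑ i, (v.1 i * q.1 i + v.2 i * q.2 i) := by
  rw [Finset.sum_add_distrib]
  rfl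

/-- The number of factors of the monomial of a configuration. -/
def numFactors (S : ZMod n → Cell) : ℤ := ∑ i, startInd (S i)

theorem IsConfig.sum_tail {M : Type*} [AddCommMonoid M] {S : ZMod n → Cell} (hS : IsConfig S)
    (g : ZMod n → M) :
    (∑ i, if S i = tail then g i else 0) = ∑ i, if S i = head then g (i + 1) else 0 := by
  rw [← sum_add_right (fun i => if S i = tail then g i else 0) 1]
  simp only [(hS _).eq_tail_iff]

theorem numFactors_eq_sum (S : ZMod n → Cell) :
    numFactors S = (∑ i, if S i = short then 1 else 0) + ∑ i, if S i = head then 1 else 0 := by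
  rw [numFactors, ← Finset.sum_add_distrib]
  exact Finset.sum_congr rfl fun i _ => startInd_eq _

theorem IsConfig.numFactors_eq_sum_tail {S : ZMod n → Cell} (hS : IsConfig S) :
    numFactors S = (∑ i, if S i = short then 1 else 0) + ∑ i, if S i = tail then 1 else 0 := by
  rw [numFactors_eq_sum, hS.sum_tail]

theorem numFactors_nonneg (S : ZMod n → Cell) : 0 ≤ numFactors S :=
  Finset.sum_nonneg fun _ _ => startInd_nonneg _

theorem IsConfig.two_mul_numFactors_le {S : ZMod n → Cell} (hS : IsConfig S) :
    2 * numFactors S ≤ n :=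
  calc 2 * numFactors S = ∑ i, (startInd (S i) + startInd (S (i + 1))) := by
        rw [Finset.sum_add_distrib, sum_add_right fun i => startInd (S i), numFactors, two_mul]
    _ ≤ ∑ _ : ZMod n, 1 := Finset.sum_le_sum fun i _ => (hS i).startInd_add_startInd_le
    _ = n := by simp [ZMod.card]

theorem dot_exponent_O (S : ZMod n → Cell) (q : Phase n) :
    dot (exponent .O S) q = ∑ i, ((if S i = short ∨ S i = tail then q.1 i else 0) +
      if S i = head then q.1 i + q.2 i else 0) := by
  rw [dot_apply]
  refine Finset.sum_congr rfl fun i _ => ?_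
  simp only [exponent, expX, expY]
  cases S i <;> simp [occInd, headInd]

theorem dot_exponent_E (S : ZMod n → Cell) (q : Phase n) :
    dot (exponent .E S) q = ∑ i, ((if S i = short ∨ S i = head then q.2 i else 0) +
      if S i = tail then q.1 i + q.2 i else 0) := by
  rw [dot_apply]
  refine Finset.sum_congr rfl fun i _ => ?_
  simp only [exponent, expX, expY]
  cases S i <;> simp [occInd, tailInd]

/-! ### Monomials and configurations -/

/-- The tropicalization of a monomial of kind `τ`. -/
def Mon.val : Kind → Mon n → Phase n → ℝ
  | .O => Mon.valO
  | .E => Mon.valE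

/-- The tropical invariants of kind `τ`. -/
noncomputable def trop : Kind → ℕ → Phase n → ℝ
  | .O => tropO
  | .E => tropE

omit [NeZero n] in
theorem trop_eq_iSup (τ : Kind) (k : ℕ) (q : Phase n) :
    trop τ k q = ⨆ μ : {μ : Mon n // μ.Admissible ∧ μ.length = k}, μ.1.val τ q := by
  cases τ <;> rfl

/-- The monomial described by a configuration. -/
def toMon (S : ZMod n → Cell) : Mon n :=
  ⟨Finset.univ.filter fun i => S i = head, Finset.univ.filter fun i => S i = short⟩

theorem length_toMon (S : ZMod n → Cell) : ((toMon S).length : ℤ) = numFactors S := by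
  simp [toMon, Mon.length, numFactors_eq_sum, add_comm]

theorem IsConfig.val_toMon {S : ZMod n → Cell} (hS : IsConfig S) (τ : Kind) (q : Phase n) :
    (toMon S).val τ q = dot (exponent τ S) q := by
  cases τ
  · have h := hS.sum_tail q.1
    rw [dot_exponent_O]
    simp only [Mon.val, Mon.valO, toMon, Finset.sum_filter, Finset.sum_add_distrib, ← h]
    simp only [← Finset.sum_add_distrib]
    exact Finset.sum_congr rfl fun i _ => by cases S i <;> simp
  · have h := hS.sum_tail fun i => q.1 i + q.2 i
    rw [dot_exponent_E, Finset.sum_add_distrib, h, ← Finset.sum_add_distrib]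
    simp only [Mon.val, Mon.valE, toMon, Finset.sum_filter, ← Finset.sum_add_distrib]
    exact Finset.sum_congr rfl fun i _ => by cases S i <;> simp [add_assoc]

omit [NeZero n] in
theorem IsConfig.neighbours_of_head {S : ZMod n → Cell} (hS : IsConfig S) {i : ZMod n}
    (hi : S i = head) :
    S (i - 2) ≠ head ∧ S (i - 1) = empty ∧ S (i + 1) = tail ∧ S (i + 2) = empty := by
  have hpred : S (i - 1) = empty := (hS.pred i).left_eq_empty (by simp [hi]) (by simp [hi])
  have hsucc : S (i + 1) = tail := (hS i).eq_tail_iff.2 hi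
  refine ⟨fun h => ?_, hpred, hsucc, ?_⟩
  · have := (hS (i - 2)).eq_tail_iff.2 h
    rw [show i - 2 + 1 = i - 1 by ring, hpred] at this
    cases this
  · have := (hS (i + 1)).right_eq_empty (by simp [hsucc]) (by simp [hsucc])
    rwa [show i + 1 + 1 = i + 2 by ring] at this

theorem IsConfig.admissible_toMon {S : ZMod n → Cell} (hS : IsConfig S) :
    (toMon S).Admissible := by
  simp only [Mon.Admissible, toMon, Finset.mem_filter, Finset.mem_univ, true_and,
    Set.mem_insert_iff, Set.mem_singleton_iff, not_or]
  refine ⟨fun i hi j hj hij => ?_, fun i hi j hj => ?_, fun i hi hj => ?_⟩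
  · obtain ⟨h₁, h₂, h₃, h₄⟩ := hS.neighbours_of_head hi
    refine ⟨?_, ?_, hij.symm, ?_, ?_⟩ <;> rintro rfl <;> simp_all
  · obtain ⟨-, h₂, h₃, h₄⟩ := hS.neighbours_of_head hi
    refine ⟨?_, ?_, ?_, ?_⟩ <;> rintro rfl <;> simp_all
  · simp [(hS i).right_eq_empty (by simp [hi]) (by simp [hi])] at hj

omit [NeZero n] in
theorem one_ne_zero_zmod (hn : 3 ≤ n) : (1 : ZMod n) ≠ 0 := by
  have : Fact (1 < n) := ⟨by omega⟩
  exact one_ne_zero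

omit [NeZero n] in
theorem two_ne_zero_zmod (hn : 3 ≤ n) : (2 : ZMod n) ≠ 0 := by
  have h : ((2 : ℕ) : ZMod n) ≠ 0 := by
    rw [Ne, ZMod.natCast_eq_zero_iff]
    exact fun h => absurd (Nat.le_of_dvd two_pos h) (by omega)
  exact_mod_cast h

open Classical in
/-- The configuration of a monomial. -/
noncomputable def Mon.config (μ : Mon n) (i : ZMod n) : Cell :=
  if i ∈ μ.long then .head else if i ∈ μ.short then .short
  else if i - 1 ∈ μ.long then .tail else .empty

omit [NeZero n] in
theorem Mon.Admissible.isConfig (hn : 3 ≤ n) {μ : Mon n} (h : μ.Admissible) :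
    IsConfig μ.config := by
  have long_long (i) (hi : i ∈ μ.long) : i + 1 ∉ μ.long ∧ i + 2 ∉ μ.long :=
    ⟨fun hj => h.1 i hi _ hj (by simpa using one_ne_zero_zmod hn) (by simp),
      fun hj => h.1 i hi _ hj (by simpa using two_ne_zero_zmod hn) (by simp)⟩
  have long_short (i) (hi : i ∈ μ.long) :
      i ∉ μ.short ∧ i + 1 ∉ μ.short ∧ i + 2 ∉ μ.short ∧ i - 1 ∉ μ.short := by
    refine ⟨?_, ?_, ?_, ?_⟩ <;> exact fun hj => h.2.1 i hi _ hj (by simp)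
  intro i
  have ll' := long_long (i - 1)
  have ls := long_short i
  have ls' := long_short (i + 1)
  have ls'' := long_short (i - 1)
  have ss := h.2.2 i
  rw [show i - 1 + 2 = i + 1 by ring, sub_add_cancel] at ll' ls''
  rw [add_sub_cancel_right] at ls'
  simp only [Mon.config, add_sub_cancel_right]
  split_ifs <;> simp_all [CanPrecede]

theorem Mon.Admissible.toMon_config {μ : Mon n} (h : μ.Admissible) : toMon μ.config = μ := by
  have hdisj (i) (hi : i ∈ μ.long) : i ∉ μ.short := fun hj => h.2.1 i hi i hj (by simp)
  have hlong (i) : μ.config i = head ↔ i ∈ μ.long := by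
    simp only [Mon.config]
    split_ifs <;> simp_all
  have hshort (i) : μ.config i = .short ↔ i ∈ μ.short := by
    have := hdisj i
    simp only [Mon.config]
    split_ifs <;> simp_all
  cases μ
  simp [toMon, hlong, hshort]

/-! ### Optimal configurations -/

/-- A configuration is optimal at `q` if it has the largest value among all configurations with
the same number of factors. -/
def IsOptimal (τ : Kind) (S : ZMod n → Cell) (q : Phase n) : Prop :=
  IsConfig S ∧ ∀ S', IsConfig S' → numFactors S' = numFactors S →
    dot (exponent τ S') q ≤ dot (exponent τ S) q

theorem IsOptimal.trop_eq (hn : 3 ≤ n) {τ : Kind} {S : ZMod n → Cell} {q : Phase n}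
    (h : IsOptimal τ S q) {k : ℕ} (hk : numFactors S = k) :
    trop τ k q = dot (exponent τ S) q := by
  have hle (μ : {μ : Mon n // μ.Admissible ∧ μ.length = k}) :
      μ.1.val τ q ≤ dot (exponent τ S) q := by
    obtain ⟨μ, hμ, hlen⟩ := μ
    have hcfg := hμ.isConfig hn
    have hval := hcfg.val_toMon τ q
    have hcount := length_toMon μ.config
    rw [hμ.toMon_config] at hval hcount
    exact hval.trans_le (h.2 _ hcfg (by rw [← hcount, hlen, hk]))
  let μ₀ : {μ : Mon n // μ.Admissible ∧ μ.length = k} :=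
    ⟨toMon S, h.1.admissible_toMon, by exact_mod_cast (length_toMon S).trans hk⟩
  have : Nonempty {μ : Mon n // μ.Admissible ∧ μ.length = k} := ⟨μ₀⟩
  rw [trop_eq_iSup]
  exact le_antisymm (ciSup_le hle)
    (le_ciSup_of_le ⟨_, Set.forall_mem_range.2 hle⟩ μ₀ (h.1.val_toMon τ q).ge)

/-- The configuration with short factors at `0, 2, …, 2 * k - 2`. -/
def evens (k : ℕ) (i : ZMod n) : Cell := if i.val % 2 = 0 ∧ i.val < 2 * k then short else empty

theorem isConfig_evens {k : ℕ} (hk : k ≤ n / 2) : IsConfig (evens k : ZMod n → Cell) := by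
  intro i
  rcases val_add_one_cases i with ⟨h, _⟩ | ⟨h, _⟩ <;> unfold evens <;> rw [h] <;>
    split_ifs <;> first | omega | simp [CanPrecede]

theorem numFactors_evens {k : ℕ} (hk : k ≤ n / 2) :
    numFactors (evens k : ZMod n → Cell) = k := by
  have hstart : ∀ t ∈ Finset.range n, startInd (evens k (0 + (t : ZMod n))) =
      if t % 2 = 0 ∧ t < 2 * k then 1 else 0 := by
    intro t ht
    rw [zero_add, evens, ZMod.val_natCast, Nat.mod_eq_of_lt (Finset.mem_range.1 ht)]
    split_ifs <;> rfl
  have hfilter : (Finset.range n).filter (fun t => t % 2 = 0 ∧ t < 2 * k) =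
      (Finset.range k).image (2 * ·) := by
    ext t
    simp only [Finset.mem_filter, Finset.mem_range, Finset.mem_image]
    exact ⟨fun ⟨_, _, _⟩ => ⟨t / 2, by omega, by omega⟩, fun ⟨j, _, _⟩ => by omega⟩
  rw [numFactors, sum_eq_sum_range _ 0, Finset.sum_congr rfl hstart, Finset.sum_boole, hfilter,
    Finset.card_image_of_injective _ (mul_right_injective₀ two_ne_zero), Finset.card_range]

theorem exists_isOptimal (τ : Kind) (q : Phase n) {k : ℕ} (hk : k ≤ n / 2) :
    ∃ S : ZMod n → Cell, IsOptimal τ S q ∧ numFactors S = k := by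
  classical
  obtain ⟨S, ⟨hS, hcount⟩, hmax⟩ :=
    (Set.toFinite {S : ZMod n → Cell | IsConfig S ∧ numFactors S = k}).exists_maximalFor
      (fun S => dot (exponent τ S) q) _ ⟨evens k, isConfig_evens hk, numFactors_evens hk⟩
  refine ⟨S, ⟨hS, fun S' hS' hcount' => ?_⟩, hcount⟩
  exact (le_total _ _).elim id (hmax ⟨hS', hcount'.trans hcount⟩)

/-! ### The reflection of the cycle -/

/-- The reflection of the phase space that exchanges the two kinds of invariants. -/
def mirror : Phase n →ₗ[ℝ] Phase n where
  toFun q := (fun i => q.2 (-i), fun i => q.1 (-i))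
  map_add' _ _ := rfl
  map_smul' _ _ := rfl

/-- The configuration seen in the reversed cycle. -/
def mirrorConfig (S : ZMod n → Cell) (i : ZMod n) : Cell := (S (-i)).reverse

omit [NeZero n] in
theorem mirror_mirror (q : Phase n) : mirror (mirror q) = q := by
  simp [mirror]

theorem dot_mirror_mirror (u v : Phase n) : dot (mirror u) (mirror v) = dot u v := by
  rw [dot_apply, dot_apply, ← sum_neg_index]
  simp [mirror, add_comm]

omit [NeZero n] in
theorem mirrorConfig_mirrorConfig (S : ZMod n → Cell) : mirrorConfig (mirrorConfig S) = S := by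
  funext i
  simp [mirrorConfig, reverse_reverse]

omit [NeZero n] in
theorem IsConfig.mirrorConfig {S : ZMod n → Cell} (hS : IsConfig S) :
    IsConfig (mirrorConfig S) := by
  intro i
  have h := hS (-(i + 1))
  rw [show -(i + 1) + 1 = -i by ring] at h
  exact (hS.pred _).reverse h

theorem IsConfig.numFactors_mirrorConfig {S : ZMod n → Cell} (hS : IsConfig S) :
    numFactors (Pentagram.mirrorConfig S) = numFactors S := by
  rw [hS.numFactors_eq_sum_tail, numFactors_eq_sum, ← sum_neg_index, ← sum_neg_index fun i =>
    if S i = tail then (1 : ℤ) else 0]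
  simp only [Pentagram.mirrorConfig, reverse_eq_short_iff, reverse_eq_head_iff, neg_neg]

omit [NeZero n] in
theorem exponent_mirrorConfig (τ : Kind) (S : ZMod n → Cell) :
    exponent τ.swap (mirrorConfig S) = mirror (exponent τ S) := by
  simp [exponent, mirror, mirrorConfig, expX_swap_reverse, expY_swap_reverse]

theorem dot_exponent_mirrorConfig (τ : Kind) (S : ZMod n → Cell) (q : Phase n) :
    dot (exponent τ.swap (mirrorConfig S)) (mirror q) = dot (exponent τ S) q := by
  rw [exponent_mirrorConfig, dot_mirror_mirror]

theorem IsOptimal.mirror {τ : Kind} {S : ZMod n → Cell} {q : Phase n} (h : IsOptimal τ S q) :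
    IsOptimal τ.swap (mirrorConfig S) (mirror q) := by
  refine ⟨h.1.mirrorConfig, fun S' hS' hcount => ?_⟩
  have := h.2 (mirrorConfig S') hS'.mirrorConfig
    (by rw [hS'.numFactors_mirrorConfig, hcount, h.1.numFactors_mirrorConfig])
  rwa [← dot_exponent_mirrorConfig τ (mirrorConfig S'), mirrorConfig_mirrorConfig,
    ← dot_exponent_mirrorConfig τ S] at this

/-! ### Invariance -/

/-- The tropicalization of `1 + x_i y_i`. -/
noncomputable def gap (q : Phase n) (i : ZMod n) : ℝ := max 0 (q.1 i + q.2 i)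

/-- Whether `x_i + y_i` is positive. -/
noncomputable def pos (q : Phase n) (i : ZMod n) : Bool := decide (0 < q.1 i + q.2 i)

/-- The tropicalization of the sum of all monomials whose factors end in the sites of `I`. The same
number is, after one step of the automaton, the tropicalization of the sum of all monomials whose
factors begin in the sites of `I`. -/
noncomputable def weight (q : Phase n) (I : ZMod n → Bool) : ℝ :=
  ∑ i, if I i then q.1 i + (if I (i - 2) then 0 else gap q (i - 1)) else 0

/-- No two neighbouring sites belong to `I`. -/
def IsSparse (I : ZMod n → Bool) : Prop := ∀ i, I i → ¬I (i + 1)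

/-- The last sites of the factors. -/
def lastSites (S : ZMod n → Cell) (i : ZMod n) : Bool := S i = short ∨ S i = tail

/-- The first sites of the factors. -/
def firstSites (S : ZMod n → Cell) (i : ZMod n) : Bool := S i = short ∨ S i = head

omit [NeZero n] in
theorem lastSites_iff {S : ZMod n → Cell} {i : ZMod n} :
    lastSites S i = true ↔ S i = short ∨ S i = tail :=
  decide_eq_true_iff

omit [NeZero n] in
theorem firstSites_iff {S : ZMod n → Cell} {i : ZMod n} :
    firstSites S i = true ↔ S i = short ∨ S i = head :=
  decide_eq_true_iff

omit [NeZero n] in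
theorem IsConfig.isSparse_lastSites {S : ZMod n → Cell} (hS : IsConfig S) :
    IsSparse (lastSites S) := by
  intro i
  have h := hS i
  rw [lastSites_iff, lastSites_iff]
  revert h; generalize S i = a; generalize S (i + 1) = b; revert a b; decide

omit [NeZero n] in
theorem IsConfig.isSparse_firstSites {S : ZMod n → Cell} (hS : IsConfig S) :
    IsSparse (firstSites S) := by
  intro i
  have h := hS i
  rw [firstSites_iff, firstSites_iff]
  revert h; generalize S i = a; generalize S (i + 1) = b; revert a b; decide

theorem numFactors_eq_sum_firstSites (S : ZMod n → Cell) :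
    numFactors S = ∑ i, if firstSites S i then 1 else 0 := by
  refine Finset.sum_congr rfl fun i _ => ?_
  simp only [firstSites_iff]
  generalize S i = a; revert a; decide

theorem IsConfig.numFactors_eq_sum_lastSites {S : ZMod n → Cell} (hS : IsConfig S) :
    numFactors S = ∑ i, if lastSites S i then 1 else 0 := by
  rw [hS.numFactors_eq_sum_tail, ← Finset.sum_add_distrib]
  refine Finset.sum_congr rfl fun i _ => ?_
  simp only [lastSites_iff]
  generalize S i = a; revert a; decide

section Weight

variable (q : Phase n)

omit [NeZero n] in
theorem gap_eq_ite_pos (i : ZMod n) : gap q i = if pos q i then q.1 i + q.2 i else 0 := by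
  by_cases h : 0 < q.1 i + q.2 i
  · simp [gap, pos, h, h.le]
  · simp [gap, pos, h, not_lt.1 h]

theorem IsConfig.dot_exponent_eq_sum_lastSites {S : ZMod n → Cell} (hS : IsConfig S) :
    dot (exponent .O S) q = ∑ i, ((if lastSites S i then q.1 i else 0) +
      if S i = tail then q.1 (i - 1) + q.2 (i - 1) else 0) := by
  simp only [lastSites_iff]
  rw [dot_exponent_O, Finset.sum_add_distrib, Finset.sum_add_distrib,
    hS.sum_tail fun i => q.1 (i - 1) + q.2 (i - 1)]
  simp only [add_sub_cancel_right]

theorem IsConfig.dot_exponent_automaton {S : ZMod n → Cell} (hS : IsConfig S) :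
    dot (exponent .O S) (automaton q) = ∑ i,
      ((if firstSites S i then q.1 i + gap q (i - 1) - gap q (i + 1) else 0) +
        if S i = head then q.1 (i + 1) + q.2 (i + 1) else 0) := by
  have hsplit : dot (exponent .O S) (automaton q) =
      ∑ i, (((if firstSites S i then (automaton q).1 i else 0) +
        if S i = head then (automaton q).2 i else 0) +
        if S i = tail then (automaton q).1 i else 0) := by
    rw [dot_exponent_O]
    refine Finset.sum_congr rfl fun i _ => ?_
    simp only [firstSites_iff]
    cases S i <;> simp
  rw [hsplit, Finset.sum_add_distrib, hS.sum_tail, ← Finset.sum_add_distrib]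
  refine Finset.sum_congr rfl fun i _ => ?_
  simp only [firstSites_iff, automaton, gap, show i + 1 + 1 = i + 2 by ring,
    add_sub_cancel_right]
  cases S i <;> grind

theorem weight_eq_forward (I : ZMod n → Bool) :
    weight q I = ∑ i, if I i then q.1 i + gap q (i - 1) - gap q (i + 1) +
      (if I (i + 2) then 0 else gap q (i + 1)) else 0 := by
  have hshift : (∑ i, if I i ∧ I (i - 2) then gap q (i - 1) else 0) =
      ∑ i, if I i ∧ I (i + 2) then gap q (i + 1) else 0 := by
    rw [← sum_add_right _ 2]
    refine Finset.sum_congr rfl fun i _ => ?_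
    simp only [add_sub_cancel_right, show i + 2 - 1 = i + 1 by ring, and_comm]
  have hweight : weight q I = (∑ i, if I i then q.1 i + gap q (i - 1) else 0) -
      ∑ i, if I i ∧ I (i - 2) then gap q (i - 1) else 0 := by
    rw [weight, ← Finset.sum_sub_distrib]
    refine Finset.sum_congr rfl fun i _ => ?_
    cases I i <;> cases I (i - 2) <;> simp
  rw [hweight, hshift, ← Finset.sum_sub_distrib]
  refine Finset.sum_congr rfl fun i _ => ?_
  cases I i <;> cases I (i + 2) <;> simp

theorem IsConfig.dot_exponent_le_weight {S : ZMod n → Cell} (hS : IsConfig S) :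
    dot (exponent .O S) q ≤ weight q (lastSites S) := by
  rw [hS.dot_exponent_eq_sum_lastSites]
  refine Finset.sum_le_sum fun i _ => ?_
  have h₁ := hS.pred i
  have h₂ := hS.pred (i - 1)
  rw [show i - 1 - 1 = i - 2 by ring] at h₂
  have hle : q.1 (i - 1) + q.2 (i - 1) ≤ gap q (i - 1) := le_max_right _ _
  have hnonneg : 0 ≤ gap q (i - 1) := le_max_left _ _
  simp only [lastSites_iff]
  cases hc : S i <;> cases hb : S (i - 1) <;> cases ha : S (i - 2) <;>
    simp [hc, hb, ha, CanPrecede] at h₁ h₂ ⊢ <;> linarith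

theorem IsConfig.dot_exponent_automaton_le_weight {S : ZMod n → Cell} (hS : IsConfig S) :
    dot (exponent .O S) (automaton q) ≤ weight q (firstSites S) := by
  rw [hS.dot_exponent_automaton, weight_eq_forward]
  refine Finset.sum_le_sum fun i _ => ?_
  have h₁ := hS i
  have h₂ := hS (i + 1)
  rw [show i + 1 + 1 = i + 2 by ring] at h₂
  have hle : q.1 (i + 1) + q.2 (i + 1) ≤ gap q (i + 1) := le_max_right _ _
  have hnonneg : 0 ≤ gap q (i + 1) := le_max_left _ _
  simp only [firstSites_iff]
  cases hc : S i <;> cases hb : S (i + 1) <;> cases ha : S (i + 2) <;>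
    simp [hc, hb, ha, CanPrecede] at h₁ h₂ ⊢ <;> linarith

/-- The configuration with last sites `I` whose factors are long where this has the larger value. -/
noncomputable def ofLast (I : ZMod n → Bool) (i : ZMod n) : Cell :=
  if I i then (if !I (i - 2) && pos q (i - 1) then tail else short)
  else if I (i + 1) && !I (i - 1) && pos q i then head else empty

/-- The configuration with first sites `I` whose factors are long where this has the larger value
after one step of the automaton. -/
noncomputable def ofFirst (I : ZMod n → Bool) (i : ZMod n) : Cell :=
  if I i then (if !I (i + 2) && pos q (i + 1) then head else short)
  else if I (i - 1) && !I (i + 1) && pos q i then tail else empty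

omit [NeZero n] in
theorem lastSites_ofLast (I : ZMod n → Bool) : lastSites (ofLast q I) = I := by
  funext i
  simp only [lastSites, ofLast]
  split_ifs <;> simp_all

omit [NeZero n] in
theorem firstSites_ofFirst (I : ZMod n → Bool) : firstSites (ofFirst q I) = I := by
  funext i
  simp only [firstSites, ofFirst]
  split_ifs <;> simp_all

omit [NeZero n] in
theorem ofLast_eq_tail_iff (I : ZMod n → Bool) (i : ZMod n) :
    ofLast q I i = tail ↔ I i ∧ ¬I (i - 2) ∧ pos q (i - 1) := by
  simp only [ofLast]
  split_ifs <;> simp_all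

omit [NeZero n] in
theorem ofFirst_eq_head_iff (I : ZMod n → Bool) (i : ZMod n) :
    ofFirst q I i = head ↔ I i ∧ ¬I (i + 2) ∧ pos q (i + 1) := by
  simp only [ofFirst]
  split_ifs <;> simp_all

variable {I : ZMod n → Bool} (hI : IsSparse I)

include hI

omit [NeZero n] in
theorem isConfig_ofLast : IsConfig (ofLast q I) := by
  intro i
  have h₁ := hI i
  have h₂ := hI (i + 1)
  simp only [ofLast, show i + 1 - 2 = i - 1 by ring, show i + 1 - 1 = i by ring,
    show i + 1 + 1 = i + 2 by ring] at h₂ ⊢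
  revert h₁ h₂
  generalize I i = a; generalize I (i + 1) = b; generalize I (i + 2) = c
  generalize I (i - 1) = d; generalize I (i - 2) = f
  generalize pos q i = u; generalize pos q (i - 1) = v; generalize pos q (i + 1) = w
  revert a b c d f u v w
  decide

omit [NeZero n] in
theorem isConfig_ofFirst : IsConfig (ofFirst q I) := by
  intro i
  have h₁ := hI i
  have h₂ := hI (i - 1)
  simp only [ofFirst, show i + 1 + 2 = i + 3 by ring, show i + 1 - 1 = i by ring,
    show i - 1 + 1 = i by ring, show i + 1 + 1 = i + 2 by ring] at h₂ ⊢
  revert h₁ h₂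
  generalize I i = a; generalize I (i + 1) = b; generalize I (i + 2) = c
  generalize I (i - 1) = d; generalize I (i + 3) = f
  generalize pos q i = u; generalize pos q (i + 1) = v; generalize pos q (i + 2) = w
  revert a b c d f u v w
  decide

theorem dot_exponent_ofLast : dot (exponent .O (ofLast q I)) q = weight q I := by
  rw [(isConfig_ofLast q hI).dot_exponent_eq_sum_lastSites, lastSites_ofLast, weight]
  refine Finset.sum_congr rfl fun i _ => ?_
  rw [if_congr (ofLast_eq_tail_iff q I i) rfl rfl, gap_eq_ite_pos]
  cases I i <;> cases I (i - 2) <;> cases pos q (i - 1) <;> simp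

theorem dot_exponent_ofFirst_automaton :
    dot (exponent .O (ofFirst q I)) (automaton q) = weight q I := by
  rw [(isConfig_ofFirst q hI).dot_exponent_automaton, firstSites_ofFirst, weight_eq_forward]
  refine Finset.sum_congr rfl fun i _ => ?_
  rw [if_congr (ofFirst_eq_head_iff q I i) rfl rfl, gap_eq_ite_pos q (i + 1)]
  cases I i <;> cases I (i + 2) <;> cases pos q (i + 1) <;> simp

end Weight

theorem trop_le_of_exists (hn : 3 ≤ n) {τ τ' : Kind} {q q' : Phase n} {k : ℕ} (hk : k ≤ n / 2)
    (h : ∀ S : ZMod n → Cell, IsConfig S → ∃ S' : ZMod n → Cell, IsConfig S' ∧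
      numFactors S' = numFactors S ∧ dot (exponent τ S) q ≤ dot (exponent τ' S') q') :
    trop τ k q ≤ trop τ' k q' := by
  obtain ⟨S, hS, hSk⟩ := exists_isOptimal τ q hk
  obtain ⟨T, hT, hTk⟩ := exists_isOptimal τ' q' hk
  obtain ⟨S', hS', hcount, hle⟩ := h S hS.1
  rw [hS.trop_eq hn hSk, hT.trop_eq hn hTk]
  exact hle.trans (hT.2 S' hS' (by rw [hcount, hSk, hTk]))

theorem trop_O_automaton (hn : 3 ≤ n) (q : Phase n) {k : ℕ} (hk : k ≤ n / 2) :
    trop .O k (automaton q) = trop .O k q := by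
  apply le_antisymm <;> refine trop_le_of_exists hn hk fun S hS => ?_
  · have hI := hS.isSparse_firstSites
    refine ⟨ofLast q (firstSites S), isConfig_ofLast q hI, ?_, ?_⟩
    · rw [(isConfig_ofLast q hI).numFactors_eq_sum_lastSites, lastSites_ofLast,
        numFactors_eq_sum_firstSites]
    · rw [dot_exponent_ofLast q hI]
      exact hS.dot_exponent_automaton_le_weight q
  · have hI := hS.isSparse_lastSites
    refine ⟨ofFirst q (lastSites S), isConfig_ofFirst q hI, ?_, ?_⟩
    · rw [numFactors_eq_sum_firstSites, firstSites_ofFirst, hS.numFactors_eq_sum_lastSites]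
    · rw [dot_exponent_ofFirst_automaton q hI]
      exact hS.dot_exponent_le_weight q

theorem trop_mirror (hn : 3 ≤ n) (τ : Kind) (q : Phase n) {k : ℕ} (hk : k ≤ n / 2) :
    trop τ.swap k (mirror q) = trop τ k q := by
  obtain ⟨S, hS, hSk⟩ := exists_isOptimal τ q hk
  rw [hS.trop_eq hn hSk, hS.mirror.trop_eq hn (by rw [hS.1.numFactors_mirrorConfig, hSk]),
    dot_exponent_mirrorConfig]

/-- Translation of the indices. -/
def translate (c : ZMod n) (q : Phase n) : Phase n := (fun i => q.1 (i + c), fun i => q.2 (i + c))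

theorem trop_le_trop_translate (hn : 3 ≤ n) (τ : Kind) (c : ZMod n) (q : Phase n) {k : ℕ}
    (hk : k ≤ n / 2) : trop τ k q ≤ trop τ k (translate c q) := by
  refine trop_le_of_exists hn hk fun S hS => ⟨fun i => S (i + c), fun i => ?_, ?_, ?_⟩
  · simpa only [add_right_comm] using hS (i + c)
  · exact sum_add_right (fun i => startInd (S i)) c
  · rw [dot_apply, dot_apply, ← sum_add_right _ c]
    rfl

theorem trop_translate (hn : 3 ≤ n) (τ : Kind) (c : ZMod n) (q : Phase n) {k : ℕ}
    (hk : k ≤ n / 2) : trop τ k (translate c q) = trop τ k q := by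
  refine le_antisymm ?_ (trop_le_trop_translate hn τ c q hk)
  simpa [translate] using trop_le_trop_translate hn τ (-c) (translate c q) hk

omit [NeZero n] in
theorem automaton_mirror (q : Phase n) :
    automaton (mirror q) = translate 1 (mirror (automaton q)) := by
  refine Prod.ext (funext fun i => ?_) (funext fun i => ?_)
  · simp only [automaton, mirror, translate, LinearMap.coe_mk, AddHom.coe_mk]
    rw [show -(i + 1) + 1 = -i by ring, show -(i + 1) + 2 = -(i - 1) by ring,
      add_comm (q.2 (-(i - 1))), add_comm (q.2 (-(i + 1)))]
  · simp only [automaton, mirror, translate, LinearMap.coe_mk, AddHom.coe_mk]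
    rw [show -(i + 1) - 1 = -(i + 2) by ring, show -(i + 1) + 1 = -i by ring,
      add_comm (q.2 (-(i + 2))), add_comm (q.2 (-i))]

theorem trop_automaton (hn : 3 ≤ n) (τ : Kind) (q : Phase n) {k : ℕ} (hk : k ≤ n / 2) :
    trop τ k (automaton q) = trop τ k q := by
  cases τ
  · exact trop_O_automaton hn q hk
  · rw [← trop_mirror hn .E (automaton q) hk, ← trop_mirror hn .E q hk,
      ← trop_translate hn _ 1 _ hk, ← automaton_mirror]
    exact trop_O_automaton hn _ hk

theorem automaton_mem_levelSet (hn : 3 ≤ n) (q : Phase n) : automaton q ∈ levelSet q := by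
  refine ⟨?_, ?_, fun k hk => ?_⟩
  · have h := sum_add_right (fun i => max 0 (q.1 (i - 1) + q.2 (i - 1))) 2
    simp only [show ∀ i : ZMod n, i + 2 - 1 = i + 1 from fun i => by ring] at h
    simp only [automaton, Finset.sum_sub_distrib, Finset.sum_add_distrib]
    linarith
  · have h₁ := sum_add_right (fun i => max 0 (q.1 i + q.2 i)) 2
    have h₂ := sum_add_right q.2 1
    simp only [automaton, Finset.sum_sub_distrib, Finset.sum_add_distrib]
    linarith
  · have hk' := (Finset.mem_Icc.1 hk).2
    exact ⟨trop_automaton hn .O q hk', trop_automaton hn .E q hk'⟩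

theorem iterate_automaton_mem_levelSet (hn : 3 ≤ n) (q : Phase n) (l : ℕ) :
    automaton^[l] q ∈ levelSet q := by
  induction l with
  | zero => exact ⟨rfl, rfl, fun _ _ => ⟨rfl, rfl⟩⟩
  | succ l ih =>
    rw [Function.iterate_succ_apply']
    obtain ⟨hx, hy, htrop⟩ := automaton_mem_levelSet hn (automaton^[l] q)
    obtain ⟨hx', hy', htrop'⟩ := ih
    exact ⟨hx.trans hx', hy.trans hy', fun k hk =>
      ⟨(htrop k hk).1.trans (htrop' k hk).1, (htrop k hk).2.trans (htrop' k hk).2⟩⟩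

/-! ### The bracket -/

/-- The linear map `v ↦ (v.1 (i + 1) - v.1 (i - 1), v.2 (i - 1) - v.2 (i + 1))`, the matrix of the
log-canonical bracket. -/
def skewShift : Phase n →ₗ[ℝ] Phase n where
  toFun v := (fun i => v.1 (i + 1) - v.1 (i - 1), fun i => v.2 (i - 1) - v.2 (i + 1))
  map_add' u v := by ext i <;> simp only [Prod.fst_add, Prod.snd_add, Pi.add_apply] <;> ring
  map_smul' c v := by
    ext i <;> simp only [Prod.smul_fst, Prod.smul_snd, Pi.smul_apply, smul_eq_mul,
      RingHom.id_apply] <;> ring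

/-- The log-canonical Poisson bracket, as a bilinear form on exponent vectors. -/
noncomputable def bracket : Phase n →ₗ[ℝ] Phase n →ₗ[ℝ] ℝ := dot.compl₂ skewShift

theorem bracket_apply (u v : Phase n) :
    bracket u v = ∑ i, (u.1 i * v.1 (i + 1) - u.1 (i + 1) * v.1 i -
      u.2 i * v.2 (i + 1) + u.2 (i + 1) * v.2 i) := by
  have h₁ := sum_add_right (fun i => u.1 i * v.1 (i - 1)) 1
  have h₂ := sum_add_right (fun i => u.2 i * v.2 (i - 1)) 1
  simp only [add_sub_cancel_right] at h₁ h₂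
  rw [bracket, LinearMap.compl₂_apply, dot_apply]
  simp only [skewShift, LinearMap.coe_mk, AddHom.coe_mk, mul_sub, Finset.sum_add_distrib,
    Finset.sum_sub_distrib, h₁, h₂]
  ring

theorem bracket_swap (u v : Phase n) : bracket u v = -bracket v u := by
  rw [bracket_apply, bracket_apply, ← Finset.sum_neg_distrib]
  exact Finset.sum_congr rfl fun i _ => by ring

theorem bracket_self (u : Phase n) : bracket u u = 0 := by
  linarith [bracket_swap u u]

theorem bracket_mirror_mirror (u v : Phase n) : bracket (mirror u) (mirror v) = bracket u v := by
  rw [bracket_apply, bracket_apply, ← sum_neg_index, ← sum_add_right _ 1]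
  refine Finset.sum_congr rfl fun i _ => ?_
  simp only [mirror, LinearMap.coe_mk, AddHom.coe_mk, neg_neg, show -(-(i + 1) + 1) = i by ring]
  ring

/-- The exponent vector of the product of all `x_i` or of all `y_i`. -/
def total : Kind → Phase n
  | .O => (1, 0)
  | .E => (0, 1)

omit [NeZero n] in
theorem mirror_total (τ : Kind) : mirror (total τ : Phase n) = total τ.swap := by
  cases τ <;> rfl

theorem bracket_total (τ : Kind) (v : Phase n) : bracket v (total τ) = 0 := by
  have hskew : skewShift (total τ : Phase n) = 0 := by
    cases τ <;> ext i <;> simp [skewShift, total]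
  rw [bracket, LinearMap.compl₂_apply, hskew, map_zero]

/-- The contribution of two neighbouring sites with states `a, b` and `a', b'` to the bracket. -/
def localBracket (τ τ' : Kind) (a a' b b' : Cell) : ℤ :=
  expX τ a * expX τ' b' - expX τ b * expX τ' a' - expY τ a * expY τ' b' + expY τ b * expY τ' a'

theorem bracket_exponent (τ τ' : Kind) (A B : ZMod n → Cell) :
    bracket (exponent τ A) (exponent τ' B) =
      ((∑ i, localBracket τ τ' (A i) (B i) (A (i + 1)) (B (i + 1)) : ℤ) : ℝ) := by
  rw [bracket_apply]
  push_cast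
  refine Finset.sum_congr rfl fun i _ => ?_
  simp only [localBracket, exponent]
  push_cast
  ring

/-! ### Genericity -/

/-- Different configurations with the same number of factors, read as monomials of the same kind,
have different values at `q`. -/
def IsGeneric (q : Phase n) : Prop :=
  ∀ (τ : Kind) (S S' : ZMod n → Cell), IsConfig S → IsConfig S' → numFactors S = numFactors S' →
    dot (exponent τ S) q = dot (exponent τ S') q → S = S'

theorem IsGeneric.mirror {q : Phase n} (h : IsGeneric q) : IsGeneric (mirror q) := by
  intro τ S S' hS hS' hcount hdot
  have heq := h τ.swap (mirrorConfig S) (mirrorConfig S') hS.mirrorConfig hS'.mirrorConfig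
    (by rw [hS.numFactors_mirrorConfig, hS'.numFactors_mirrorConfig, hcount])
    (by rw [← mirror_mirror q, dot_exponent_mirrorConfig, dot_exponent_mirrorConfig, hdot])
  rw [← mirrorConfig_mirrorConfig S, heq, mirrorConfig_mirrorConfig]

theorem IsGeneric.eq_of_rearrangement {q : Phase n} (h : IsGeneric q) {τ τ' : Kind}
    {A B A' B' : ZMod n → Cell} (hA : IsOptimal τ A q) (hB : IsOptimal τ' B q)
    (hA' : IsConfig A') (hB' : IsConfig B') (hcountA : numFactors A' = numFactors A)
    (hcountB : numFactors B' = numFactors B)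
    (hsum : exponent τ A' + exponent τ' B' = exponent τ A + exponent τ' B) :
    A' = A ∧ B' = B := by
  have hleA := hA.2 A' hA' hcountA
  have hleB := hB.2 B' hB' hcountB
  have hdot := congrArg (fun v => dot v q) hsum
  simp only [map_add, LinearMap.add_apply] at hdot
  exact ⟨h τ A' A hA' hA.1 hcountA (by linarith), h τ' B' B hB' hB.1 hcountB (by linarith)⟩

/-! ### Cutting the cycle at the common empty sites -/

/-- `i` and `i + k` are consecutive sites with property `P`. -/
structure IsSegment (P : ZMod n → Prop) (i : ZMod n) (k : ℕ) : Prop where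
  left : P i
  right : P (i + k)
  pos : 0 < k
  le : k ≤ n
  mid : ∀ t : ℕ, 0 < t → t < k → ¬P (i + t)

theorem exists_isSegment {P : ZMod n → Prop} {i : ZMod n} (h : P i) : ∃ k, IsSegment P i k := by
  classical
  have hn : 0 < n ∧ P (i + n) := ⟨NeZero.pos n, by simpa using h⟩
  have hex : ∃ k : ℕ, 0 < k ∧ P (i + k) := ⟨n, hn⟩
  exact ⟨Nat.find hex, h, (Nat.find_spec hex).2, (Nat.find_spec hex).1, Nat.find_min' hex hn,
    fun t ht hlt hP => Nat.find_min hex hlt ⟨ht, hP⟩⟩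

theorem sum_nonpos_of_segments {P : ZMod n → Prop} {i₀ : ZMod n} (h₀ : P i₀) (g : ZMod n → ℤ)
    (h : ∀ i k, IsSegment P i k → ∑ t ∈ Finset.range k, g (i + t) ≤ 0) : ∑ i, g i ≤ 0 := by
  suffices key : ∀ (k : ℕ) (i : ZMod n), P i → P (i + k) →
      ∑ t ∈ Finset.range k, g (i + t) ≤ 0 by
    rw [sum_eq_sum_range g i₀]
    exact key n i₀ h₀ (by simpa using h₀)
  intro k
  induction k using Nat.strong_induction_on with
  | _ k ih =>
    intro i hi hk
    rcases Nat.eq_zero_or_pos k with rfl | hpos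
    · simp
    obtain ⟨k₁, hs⟩ := exists_isSegment hi
    have hle : k₁ ≤ k := not_lt.1 fun hlt => hs.mid k hpos hlt hk
    obtain ⟨r, rfl⟩ := Nat.exists_eq_add_of_le hle
    have hrest := ih r (by have := hs.pos; omega) (i + k₁) hs.right (by simpa [add_assoc] using hk)
    have hfirst := h i k₁ hs
    rw [Finset.sum_range_add]
    simp only [Nat.cast_add, ← add_assoc] at hrest ⊢
    linarith

theorem sum_ite_val_lt {M : Type*} [AddCommMonoid M] (g : ZMod n → M) (i : ZMod n) {k : ℕ}
    (hk : k ≤ n) :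
    (∑ j, if (j - i).val < k then g j else 0) = ∑ t ∈ Finset.range k, g (i + t) := by
  have hval : ∀ t ∈ Finset.range n, (if ((i + t : ZMod n) - i).val < k then g (i + t) else 0) =
      if t < k then g (i + t) else 0 := by
    intro t ht
    rw [add_sub_cancel_left, ZMod.val_natCast, Nat.mod_eq_of_lt (Finset.mem_range.1 ht)]
  rw [sum_eq_sum_range _ i, Finset.sum_congr rfl hval, ← Finset.sum_filter]
  congr 1
  ext t
  simp only [Finset.mem_filter, Finset.mem_range]
  omega

/-- Replace `A` by `B` on the `k` sites from `i` on. -/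
def splice (i : ZMod n) (k : ℕ) (A B : ZMod n → Cell) (j : ZMod n) : Cell :=
  if (j - i).val < k then B j else A j

/-- The site is empty in both configurations. -/
def CommonEmpty (A B : ZMod n → Cell) (i : ZMod n) : Prop := A i = empty ∧ B i = empty

omit [NeZero n] in
theorem CommonEmpty.symm {A B : ZMod n → Cell} {i : ZMod n} (h : CommonEmpty A B i) :
    CommonEmpty B A i :=
  ⟨h.2, h.1⟩

theorem isConfig_splice {A B : ZMod n → Cell} (hA : IsConfig A) (hB : IsConfig B) {i : ZMod n}
    {k : ℕ} (h₀ : CommonEmpty A B i) (hk : CommonEmpty A B (i + k)) :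
    IsConfig (splice i k A B) := by
  intro j
  have hAj := hA j
  have hBj := hB j
  simp only [splice, show j + 1 - i = j - i + 1 by ring]
  rcases val_add_one_cases (j - i) with ⟨hval, -⟩ | ⟨hval, -⟩
  · rw [hval]
    split_ifs with h₁ h₂ h₂
    · exact hBj
    · have hend : j + 1 = i + k := by
        rw [← show (j - i).val + 1 = k by omega, Nat.cast_succ, ZMod.natCast_zmod_val]
        ring
      rw [hend] at hBj ⊢
      rwa [hk.1, ← hk.2]
    · omega
    · exact hAj
  · have hstart : j + 1 = i := by
      linear_combination (ZMod.val_eq_zero _).1 hval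
    rw [hval, hstart]
    rw [hstart, h₀.1] at hAj
    rw [hstart, h₀.2] at hBj
    split_ifs <;> simpa only [h₀.1, h₀.2]

omit [NeZero n] in
theorem exponent_splice (τ : Kind) (i : ZMod n) (k : ℕ) (A B : ZMod n → Cell) :
    exponent τ (splice i k A B) + exponent τ (splice i k B A) = exponent τ A + exponent τ B := by
  ext j <;> simp only [exponent, Prod.fst_add, Prod.snd_add, Pi.add_apply, splice] <;>
    split_ifs <;> ring

/-- The difference of the numbers of factors of two configurations on the `k` sites from `i` on. -/
def countDiff (A B : ZMod n → Cell) (i : ZMod n) (k : ℕ) : ℤ :=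
  ∑ t ∈ Finset.range k, (startInd (A (i + t)) - startInd (B (i + t)))

/-- The part of the bracket of two monomials of kind `O` that comes from the `k` pairs of
neighbouring sites from `i` on. -/
def bracketOn (A B : ZMod n → Cell) (i : ZMod n) (k : ℕ) : ℤ :=
  ∑ t ∈ Finset.range k,
    localBracket .O .O (A (i + t)) (B (i + t)) (A (i + t + 1)) (B (i + t + 1))

theorem numFactors_splice {i : ZMod n} {k : ℕ} (hk : k ≤ n) (A B : ZMod n → Cell) :
    numFactors (splice i k A B) = numFactors A - countDiff A B i k := by
  rw [countDiff, ← sum_ite_val_lt (fun j => startInd (A j) - startInd (B j)) i hk, numFactors,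
    numFactors, ← Finset.sum_sub_distrib]
  refine Finset.sum_congr rfl fun j _ => ?_
  simp only [splice]
  split_ifs <;> ring

omit [NeZero n] in
theorem countDiff_swap (A B : ZMod n → Cell) (i : ZMod n) (k : ℕ) :
    countDiff B A i k = -countDiff A B i k := by
  simp only [countDiff, ← Finset.sum_neg_distrib, neg_sub]

/-- Which of two configurations has the next factor behind a common empty site, as a sign; if both
have one, a short factor precedes a long one. -/
def lead : Cell → Cell → ℤ
  | short, empty | head, empty | short, head => 1
  | empty, short | empty, head | head, short => -1
  | _, _ => 0

/-- A function of the states at one site whose difference between neighbouring sites is the local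
number of factors plus the local bracket, away from the common empty sites. -/
def countAddBracketPotential : Cell → Cell → ℤ
  | short, head | tail, head => -1
  | head, short | head, tail => 1
  | _, _ => 0

/-- A function of the states at one site whose difference between neighbouring sites is the local
number of factors minus the local bracket, away from the common empty sites. -/
def countSubBracketPotential : Cell → Cell → ℤ
  | empty, short | empty, head | empty, tail | tail, short => -1
  | short, empty | head, empty | tail, empty | short, tail => 1
  | _, _ => 0

theorem startInd_add_localBracket : ∀ a a' b b', CanPrecede a b → CanPrecede a' b' →
    startInd b - startInd b' + localBracket .O .O a a' b b' =
      countAddBracketPotential b b' - countAddBracketPotential a a' +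
        if a = empty ∧ a' = empty then lead b b' else 0 := by
  decide

theorem startInd_sub_localBracket : ∀ a a' b b', CanPrecede a b → CanPrecede a' b' →
    startInd b - startInd b' - localBracket .O .O a a' b b' =
      countSubBracketPotential b b' - countSubBracketPotential a a' +
        if b = empty ∧ b' = empty then countSubBracketPotential a a' else 0 := by
  decide

theorem abs_lead_le : ∀ a b, |lead a b| ≤ 1 := by decide

theorem abs_countSubBracketPotential_le : ∀ a b, |countSubBracketPotential a b| ≤ 1 := by decide

theorem lead_self : ∀ a, lead a a = 0 := by decide

section Segments

variable {A B : ZMod n → Cell}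

omit [NeZero n] in
theorem IsSegment.countDiff_eq_shift {i : ZMod n} {k : ℕ} (h : IsSegment (CommonEmpty A B) i k) :
    countDiff A B i k =
      ∑ t ∈ Finset.range k, (startInd (A (i + t + 1)) - startInd (B (i + t + 1))) := by
  have hlast := Finset.sum_range_succ
    (fun t : ℕ => startInd (A (i + t)) - startInd (B (i + t))) k
  rw [Finset.sum_range_succ'] at hlast
  simp only [h.right.1, h.right.2, Nat.cast_zero, add_zero, h.left.1, h.left.2, sub_self,
    Nat.cast_succ, ← add_assoc] at hlast
  exact hlast.symm

omit [NeZero n] in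
theorem IsSegment.eq_of_splice_eq {i : ZMod n} {k : ℕ} (hs : IsSegment (CommonEmpty A B) i k)
    (h : splice i k A B = A) : A (i + 1) = B (i + 1) := by
  rcases Nat.lt_or_ge 1 k with hk | hk
  · have hval : (i + 1 - i).val = 1 := by
      have : Fact (1 < n) := ⟨hk.trans_le hs.le⟩
      rw [add_sub_cancel_left, ZMod.val_one]
    have hsplice := congrFun h (i + 1)
    rw [splice, if_pos (by rwa [hval])] at hsplice
    exact hsplice.symm
  · obtain rfl : k = 1 := le_antisymm hk hs.pos
    have hright := hs.right
    rw [Nat.cast_one] at hright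
    rw [hright.1, hright.2]

variable (hA : IsConfig A) (hB : IsConfig B)

include hA hB

omit [NeZero n] in
theorem IsSegment.countDiff_add_bracketOn {i : ZMod n} {k : ℕ}
    (h : IsSegment (CommonEmpty A B) i k) :
    countDiff A B i k + bracketOn A B i k = lead (A (i + 1)) (B (i + 1)) := by
  have hlocal : ∀ t ∈ Finset.range k, startInd (A (i + t + 1)) - startInd (B (i + t + 1)) +
      localBracket .O .O (A (i + t)) (B (i + t)) (A (i + t + 1)) (B (i + t + 1)) =
      (countAddBracketPotential (A (i + (t + 1 : ℕ))) (B (i + (t + 1 : ℕ))) -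
        countAddBracketPotential (A (i + t)) (B (i + t))) +
        if t = 0 then lead (A (i + 1)) (B (i + 1)) else 0 := by
    intro t ht
    rw [startInd_add_localBracket _ _ _ _ (hA _) (hB _), Nat.cast_succ, ← add_assoc]
    congr 1
    rcases Nat.eq_zero_or_pos t with rfl | hpos
    · simp [h.left.1, h.left.2]
    · rw [if_neg (show ¬(_ ∧ _) from h.mid t hpos (Finset.mem_range.1 ht)), if_neg hpos.ne']
  rw [h.countDiff_eq_shift, bracketOn, ← Finset.sum_add_distrib, Finset.sum_congr rfl hlocal,
    Finset.sum_add_distrib,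
    Finset.sum_range_sub fun t : ℕ => countAddBracketPotential (A (i + t)) (B (i + t))]
  simp [h.right.1, h.right.2, h.left.1, h.left.2, h.pos]

omit [NeZero n] in
theorem IsSegment.abs_countDiff_sub_bracketOn_le {i : ZMod n} {k : ℕ}
    (h : IsSegment (CommonEmpty A B) i k) : |countDiff A B i k - bracketOn A B i k| ≤ 1 := by
  have hlocal : ∀ t ∈ Finset.range k, startInd (A (i + t + 1)) - startInd (B (i + t + 1)) -
      localBracket .O .O (A (i + t)) (B (i + t)) (A (i + t + 1)) (B (i + t + 1)) =
      (countSubBracketPotential (A (i + (t + 1 : ℕ))) (B (i + (t + 1 : ℕ))) -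
        countSubBracketPotential (A (i + t)) (B (i + t))) +
        if t = k - 1 then countSubBracketPotential (A (i + t)) (B (i + t)) else 0 := by
    intro t ht
    have htk := Finset.mem_range.1 ht
    rw [startInd_sub_localBracket _ _ _ _ (hA _) (hB _), Nat.cast_succ, ← add_assoc]
    congr 1
    by_cases hk : t = k - 1
    · have hright := h.right
      rw [show k = t + 1 by omega, CommonEmpty, Nat.cast_succ, ← add_assoc] at hright
      rw [if_pos hright, if_pos hk]
    · have hmid := h.mid (t + 1) (by omega) (by omega)
      rw [CommonEmpty, Nat.cast_succ, ← add_assoc] at hmid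
      rw [if_neg hmid, if_neg hk]
  rw [h.countDiff_eq_shift, bracketOn, ← Finset.sum_sub_distrib, Finset.sum_congr rfl hlocal,
    Finset.sum_add_distrib,
    Finset.sum_range_sub fun t : ℕ => countSubBracketPotential (A (i + t)) (B (i + t))]
  have hlast : k - 1 < k := by have := h.pos; omega
  simp only [h.right.1, h.right.2, h.left.1, h.left.2, Nat.cast_zero, add_zero, sub_self,
    zero_add, Finset.sum_ite_eq', Finset.mem_range, hlast, if_true]
  exact abs_countSubBracketPotential_le _ _

omit [NeZero n] in
theorem IsSegment.countDiff_cases {i : ZMod n} {k : ℕ} (h : IsSegment (CommonEmpty A B) i k) :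
    (countDiff A B i k = 0 ∧ bracketOn A B i k = lead (A (i + 1)) (B (i + 1))) ∨
      ((countDiff A B i k = 1 ∨ countDiff A B i k = -1) ∧ bracketOn A B i k = 0) := by
  have hadd := h.countDiff_add_bracketOn hA hB
  have hsub := h.abs_countDiff_sub_bracketOn_le hA hB
  have hlead := abs_lead_le (A (i + 1)) (B (i + 1))
  rw [abs_le] at hsub hlead
  omega

theorem numFactors_eq_of_no_commonEmpty (h : ∀ i, ¬CommonEmpty A B i) :
    numFactors A = numFactors B ∧
      ∑ i, localBracket .O .O (A i) (B i) (A (i + 1)) (B (i + 1)) = 0 := by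
  have hadd : ∑ i, (startInd (A (i + 1)) - startInd (B (i + 1)) +
      localBracket .O .O (A i) (B i) (A (i + 1)) (B (i + 1))) =
      ∑ i, (countAddBracketPotential (A (i + 1)) (B (i + 1)) -
        countAddBracketPotential (A i) (B i)) := by
    refine Finset.sum_congr rfl fun i _ => ?_
    rw [startInd_add_localBracket _ _ _ _ (hA _) (hB _), if_neg (show ¬(_ ∧ _) from h i), add_zero]
  have hsub : ∑ i, (startInd (A (i + 1)) - startInd (B (i + 1)) -
      localBracket .O .O (A i) (B i) (A (i + 1)) (B (i + 1))) =
      ∑ i, (countSubBracketPotential (A (i + 1)) (B (i + 1)) -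
        countSubBracketPotential (A i) (B i)) := by
    refine Finset.sum_congr rfl fun i _ => ?_
    rw [startInd_sub_localBracket _ _ _ _ (hA _) (hB _), if_neg (show ¬(_ ∧ _) from h (i + 1)),
      add_zero]
  simp only [Finset.sum_add_distrib, Finset.sum_sub_distrib,
    sum_add_right (fun i => countAddBracketPotential (A i) (B i)) 1,
    sum_add_right (fun i => countSubBracketPotential (A i) (B i)) 1,
    sum_add_right (fun i => startInd (A i)) 1, sum_add_right (fun i => startInd (B i)) 1]
    at hadd hsub
  simp only [numFactors]
  omega

theorem exists_rearrangement_of_numFactors_eq_add_two (h : numFactors A = numFactors B + 2) :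
    ∃ C D : ZMod n → Cell, IsConfig C ∧ IsConfig D ∧ C ≠ D ∧ numFactors C = numFactors B + 1 ∧
      numFactors D = numFactors B + 1 ∧
      ∀ τ, exponent τ C + exponent τ D = exponent τ A + exponent τ B := by
  obtain ⟨i₀, h₀⟩ : ∃ i, CommonEmpty A B i := by
    by_contra! hno
    have := (numFactors_eq_of_no_commonEmpty hA hB hno).1
    omega
  obtain ⟨i, k, hs, hpos⟩ : ∃ i k, IsSegment (CommonEmpty A B) i k ∧ 0 < countDiff A B i k := by
    by_contra! hno
    have := sum_nonpos_of_segments h₀ (fun i => startInd (A i) - startInd (B i)) hno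
    rw [Finset.sum_sub_distrib] at this
    simp only [numFactors] at h
    omega
  have hone : countDiff A B i k = 1 := by
    rcases hs.countDiff_cases hA hB with hcases | hcases <;> omega
  refine ⟨splice i k A B, splice i k B A, isConfig_splice hA hB hs.left hs.right,
    isConfig_splice hB hA hs.left.symm hs.right.symm, fun heq => ?_, ?_, ?_,
    fun τ => exponent_splice ..⟩
  · have hAB : A = B := by
      funext j
      have hj := congrFun heq j
      simp only [splice] at hj
      split_ifs at hj
      exacts [hj.symm, hj]
    rw [hAB] at h
    omega
  · rw [numFactors_splice hs.le]; omega
  · rw [numFactors_splice hs.le, countDiff_swap]; omega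

end Segments

/-- The segments on which the numbers of factors agree could be exchanged between the two optimal
configurations, so by genericity the configurations agree there; all other segments contribute
nothing to the bracket. -/
theorem IsGeneric.bracket_exponent_O_eq_zero {q : Phase n} (hq : IsGeneric q)
    {A B : ZMod n → Cell} (hA : IsOptimal .O A q) (hB : IsOptimal .O B q) :
    bracket (exponent .O A) (exponent .O B) = 0 := by
  rw [bracket_exponent]
  norm_cast
  by_cases hex : ∃ i, CommonEmpty A B i
  swap
  · exact (numFactors_eq_of_no_commonEmpty hA.1 hB.1 (not_exists.1 hex)).2
  obtain ⟨i₀, h₀⟩ := hex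
  have hsegment : ∀ i k, IsSegment (CommonEmpty A B) i k → bracketOn A B i k = 0 := by
    intro i k hs
    rcases hs.countDiff_cases hA.1 hB.1 with ⟨hcount, hlead⟩ | ⟨-, hzero⟩
    swap
    · exact hzero
    have hsplice := (hq.eq_of_rearrangement hA hB (isConfig_splice hA.1 hB.1 hs.left hs.right)
      (isConfig_splice hB.1 hA.1 hs.left.symm hs.right.symm)
      (by rw [numFactors_splice hs.le, hcount, sub_zero])
      (by rw [numFactors_splice hs.le, countDiff_swap, hcount, neg_zero, sub_zero])
      (exponent_splice ..)).1
    rw [hlead, hs.eq_of_splice_eq hsplice, lead_self]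
  refine le_antisymm (sum_nonpos_of_segments h₀ _ fun i k hs => (hsegment i k hs).le) ?_
  rw [← neg_nonpos, ← Finset.sum_neg_distrib]
  refine sum_nonpos_of_segments h₀ _ fun i k hs => ?_
  rw [Finset.sum_neg_distrib]
  exact neg_nonpos.2 (hsegment i k hs).ge

theorem exists_lead_ne_zero {A B : ZMod n → Cell} (hA : IsConfig A) (hB : IsConfig B)
    (hne : A ≠ B) {i₀ : ZMod n} (h₀ : CommonEmpty A B i₀) :
    ∃ i, CommonEmpty A B i ∧ lead (A (i + 1)) (B (i + 1)) ≠ 0 := by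
  by_contra! hno
  apply hne
  have hcell : ∀ a b c : Cell, CanPrecede a b → CanPrecede a c →
      (a = empty ∧ a = empty → lead b c = 0) → b = c := by
    decide
  have heq : ∀ t : ℕ, A (i₀ + t) = B (i₀ + t) := by
    intro t
    induction t with
    | zero => simp [h₀.1, h₀.2]
    | succ t ih =>
      have hBt := hB (i₀ + t)
      have hlead := hno (i₀ + t)
      rw [CommonEmpty, ← ih] at hlead
      rw [← ih] at hBt
      rw [Nat.cast_succ, ← add_assoc]
      exact hcell _ _ _ (hA _) hBt hlead
  funext j
  simpa using heq (j - i₀).val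

theorem bracket_exponent_O_of_sub_eq_smul {A B : ZMod n → Cell} {i : ZMod n} {k : ℕ}
    (hk : k ≤ n) (hi : CommonEmpty A B i) {c : ℝ}
    (hline : exponent .O B - exponent .O A =
      c • (exponent .O (splice i k A B) - exponent .O A)) :
    bracket (exponent .O A) (exponent .O B) = bracketOn A B i k := by
  have hout : ∀ j, ¬(j - i).val < k →
      occInd (A j) = occInd (B j) ∧ headInd (A j) = headInd (B j) := by
    intro j hj
    have hx := congrFun (congrArg Prod.fst hline) j
    have hy := congrFun (congrArg Prod.snd hline) j
    simp only [exponent, splice, if_neg hj, Prod.fst_sub, Prod.snd_sub, Prod.smul_fst,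
      Prod.smul_snd, Pi.sub_apply, Pi.smul_apply, sub_self, smul_zero, expX, expY,
      sub_eq_zero] at hx hy
    exact ⟨by exact_mod_cast hx.symm, by exact_mod_cast hy.symm⟩
  have hnext : ∀ j, ¬(j - i).val < k →
      occInd (A (j + 1)) = occInd (B (j + 1)) ∧ headInd (A (j + 1)) = headInd (B (j + 1)) := by
    intro j hj
    by_cases hj' : (j + 1 - i).val < k
    · have hji : j + 1 = i := by
        rw [show j + 1 - i = j - i + 1 by ring] at hj'
        rcases val_add_one_cases (j - i) with ⟨hval, -⟩ | ⟨hval, -⟩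
        · omega
        · linear_combination (ZMod.val_eq_zero _).1 hval
      rw [hji, hi.1, hi.2]
      exact ⟨rfl, rfl⟩
    · exact hout _ hj'
  rw [bracket_exponent, bracketOn, ← sum_ite_val_lt
    (fun j => localBracket .O .O (A j) (B j) (A (j + 1)) (B (j + 1))) i hk]
  refine congrArg _ (Finset.sum_congr rfl fun j _ => ?_)
  split_ifs with hj
  · rfl
  simp only [localBracket, expX, expY, hout j hj, hnext j hj]
  ring

/-- The hypothesis on `c` in the second alternative is the situation at a wall, where all
differences of competing exponent vectors are parallel. -/
theorem exists_rearrangement_of_commonEmpty {A B : ZMod n → Cell} (hA : IsConfig A)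
    (hB : IsConfig B) (hcount : numFactors A = numFactors B) (hne : A ≠ B)
    (hex : ∃ i, CommonEmpty A B i) :
    (∃ C D : ZMod n → Cell, IsConfig C ∧ IsConfig D ∧ numFactors C = numFactors A + 1 ∧
      numFactors D = numFactors A - 1 ∧
      ∀ τ, exponent τ C + exponent τ D = exponent τ A + exponent τ B) ∨
    ∃ C D : ZMod n → Cell, IsConfig C ∧ IsConfig D ∧ numFactors C = numFactors A ∧
      numFactors D = numFactors A ∧ C ≠ A ∧
      (∀ τ, exponent τ C + exponent τ D = exponent τ A + exponent τ B) ∧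
      ∀ c : ℝ, exponent .O B - exponent .O A = c • (exponent .O C - exponent .O A) →
        bracket (exponent .O A) (exponent .O B) ≠ 0 := by
  obtain ⟨i₀, h₀⟩ := hex
  obtain ⟨i, hi, hlead⟩ := exists_lead_ne_zero hA hB hne h₀
  obtain ⟨k, hs⟩ := exists_isSegment hi
  have hC := isConfig_splice hA hB hs.left hs.right
  have hD := isConfig_splice hB hA hs.left.symm hs.right.symm
  have hcountC := numFactors_splice (i := i) hs.le A B
  have hcountD := numFactors_splice (i := i) hs.le B A
  rw [countDiff_swap] at hcountD
  rcases hs.countDiff_cases hA hB with ⟨hdiff, hbracket⟩ | ⟨hdiff | hdiff, -⟩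
  · refine .inr ⟨_, _, hC, hD, by omega, by omega, fun heq => ?_,
      fun τ => exponent_splice .., fun c hline => ?_⟩
    · exact hlead (by rw [hs.eq_of_splice_eq heq, lead_self])
    · rw [bracket_exponent_O_of_sub_eq_smul hs.le hi hline, hbracket]
      exact_mod_cast hlead
  · exact .inl ⟨_, _, hD, hC, by omega, by omega, fun τ => by rw [add_comm, exponent_splice]⟩
  · exact .inl ⟨_, _, hC, hD, by omega, by omega, fun τ => exponent_splice ..⟩

/-! ### The bracket of two monomials of different kinds -/

/-- The pairs of states at the inner sites of a window, on which long factors of the two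
configurations alternate. -/
def IsInner (a a' : Cell) : Prop :=
  (a = head ∧ a' = empty) ∨ (a = tail ∧ a' = head) ∨ (a = empty ∧ a' = tail)

/-- The pairs of states at the first site of a window. -/
def IsFirst (a a' : Cell) : Prop := (a = short ∧ a' = head) ∨ (a = empty ∧ a' = short)

/-- The pairs of states at the last site of a window, behind which the first configuration has the
state `b`. -/
def IsLast (a a' b : Cell) : Prop :=
  (a = empty ∧ a' = tail ∧ b = empty) ∨ (a = tail ∧ a' = empty)

instance : DecidableRel IsInner := fun _ _ => by unfold IsInner; infer_instance

instance : DecidableRel IsFirst := fun _ _ => by unfold IsFirst; infer_instance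

instance (a a' b : Cell) : Decidable (IsLast a a' b) := by unfold IsLast; infer_instance

theorem IsInner.not_isFirst : ∀ {a a' : Cell}, IsInner a a' → ¬IsFirst a a' := by decide

theorem IsLast.not_isFirst : ∀ {a a' b : Cell}, IsLast a a' b → ¬IsFirst a a' := by decide

theorem IsLast.not_isInner_succ : ∀ {a a' b b' : Cell}, IsLast a a' b → IsInner a a' →
    CanPrecede a' b' → ¬IsInner b b' := by
  decide

/-- The position of a site relative to the windows on which two configurations are exchanged. -/
inductive Position
  | outside | first | inner | last
  deriving DecidableEq

instance : Fintype Position :=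
  ⟨{.outside, .first, .inner, .last}, fun p => by cases p <;> decide⟩

namespace Position

/-- The positions of neighbouring sites: each window is a first site, inner sites and a last
site. -/
def CanPrecede (p p' : Position) : Prop := (p = outside ∨ p = last) ↔ (p' = outside ∨ p' = first)

instance : DecidableRel CanPrecede := fun _ _ => by unfold CanPrecede; infer_instance

/-- The states `a`, `a'` of the two configurations are admitted at the position if the next state of
the first configuration is `b`. -/
def Admits (p : Position) (a a' b : Cell) : Prop :=
  match p with
  | outside => True
  | first => IsFirst a a'
  | inner => IsInner a a'
  | last => IsLast a a' b

instance (p : Position) (a a' b : Cell) : Decidable (p.Admits a a' b) := by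
  cases p <;> unfold Admits <;> infer_instance

/-- The states of the two configurations after the exchange. -/
def exchange : Position → Cell → Cell → Cell × Cell
  | outside, a, a' => (a, a')
  | first, short, _ => (head, empty)
  | first, _, _ => (empty, head)
  | inner, head, _ => (empty, tail)
  | inner, tail, _ => (head, empty)
  | inner, _, _ => (tail, head)
  | last, tail, _ => (short, empty)
  | last, _, _ => (tail, short)

/-- The indicator of the tails in the windows. -/
def tailInWindow (p : Position) (a : Cell) : ℤ := if p = outside then 0 else tailInd a

set_option synthInstance.maxSize 1000 in
theorem canPrecede_exchange : ∀ p p', CanPrecede p p' → ∀ a b, Cell.CanPrecede a b →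
    ∀ a', p.Admits a a' b → ∀ b', Cell.CanPrecede a' b' → ∀ c, p'.Admits b b' c →
    Cell.CanPrecede (exchange p a a').1 (exchange p' b b').1 ∧
      Cell.CanPrecede (exchange p a a').2 (exchange p' b b').2 := by
  decide

set_option synthInstance.maxSize 1000 in
theorem startInd_exchange : ∀ p p', CanPrecede p p' → ∀ a b, Cell.CanPrecede a b →
    ∀ a', p.Admits a a' b → ∀ b', Cell.CanPrecede a' b' → ∀ c, p'.Admits b b' c →
    startInd (exchange p a a').1 = startInd a + (tailInWindow p a - tailInWindow p' b) ∧
      startInd (exchange p a a').2 = startInd a' + (tailInWindow p a' - tailInWindow p' b') := by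
  decide

theorem exp_exchange : ∀ p a a' b, Admits p a a' b →
    expX .O (exchange p a a').1 + expX .E (exchange p a a').2 = expX .O a + expX .E a' ∧
      expY .O (exchange p a a').1 + expY .E (exchange p a a').2 = expY .O a + expY .E a' := by
  decide

theorem exchange_first_ne : ∀ a a' b, Admits first a a' b → exchange first a a' ≠ (a, a') := by
  decide

end Position

section Windows

open Position

/-- The sites are labelled by their positions relative to a set of windows. -/
structure IsWindowing (A B : ZMod n → Cell) (p : ZMod n → Position) : Prop where
  canPrecede : ∀ i, (p i).CanPrecede (p (i + 1))
  admits : ∀ i, (p i).Admits (A i) (B i) (A (i + 1))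

namespace IsWindowing

variable {A B : ZMod n → Cell} {p : ZMod n → Position}

omit [NeZero n] in
theorem exponent_exchange (h : IsWindowing A B p) :
    exponent .O (fun i => ((p i).exchange (A i) (B i)).1) +
      exponent .E (fun i => ((p i).exchange (A i) (B i)).2) = exponent .O A + exponent .E B := by
  ext i <;> simp only [exponent, Prod.fst_add, Prod.snd_add, Pi.add_apply]
  · exact mod_cast (exp_exchange _ _ _ _ (h.admits i)).1
  · exact mod_cast (exp_exchange _ _ _ _ (h.admits i)).2

omit [NeZero n] in
theorem exchange_ne (h : IsWindowing A B p) {i : ZMod n} (hi : p i = first) :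
    ¬((fun i => ((p i).exchange (A i) (B i)).1) = A ∧
      (fun i => ((p i).exchange (A i) (B i)).2) = B) := by
  rintro ⟨hA, hB⟩
  have hfirst := h.admits i
  rw [hi] at hfirst
  have hAi := congrFun hA i
  have hBi := congrFun hB i
  rw [hi] at hAi hBi
  exact exchange_first_ne _ _ _ hfirst (Prod.ext hAi hBi)

variable (h : IsWindowing A B p) (hA : IsConfig A) (hB : IsConfig B)

include h hA hB

omit [NeZero n] in
theorem isConfig_exchange : IsConfig (fun i => ((p i).exchange (A i) (B i)).1) ∧
    IsConfig (fun i => ((p i).exchange (A i) (B i)).2) :=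
  forall_and.1 fun i => canPrecede_exchange _ _ (h.canPrecede i) _ _ (hA i) _ (h.admits i) _ (hB i)
    _ (h.admits (i + 1))

theorem numFactors_exchange : numFactors (fun i => ((p i).exchange (A i) (B i)).1) = numFactors A ∧
    numFactors (fun i => ((p i).exchange (A i) (B i)).2) = numFactors B := by
  have hlocal := forall_and.1 fun i => startInd_exchange _ _ (h.canPrecede i) _ _ (hA i) _
    (h.admits i) _ (hB i) _ (h.admits (i + 1))
  constructor
  · simp only [numFactors, hlocal.1, Finset.sum_add_distrib, Finset.sum_sub_distrib,
      sum_add_right (fun i => tailInWindow (p i) (A i)) 1, sub_self, add_zero]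
  · simp only [numFactors, hlocal.2, Finset.sum_add_distrib, Finset.sum_sub_distrib,
      sum_add_right (fun i => tailInWindow (p i) (B i)) 1, sub_self, add_zero]

end IsWindowing

/-- The site belongs to a piece of two configurations that starts like a window. -/
inductive InRun (A B : ZMod n → Cell) : ZMod n → Prop
  | first {i : ZMod n} : IsFirst (A i) (B i) → InRun A B i
  | inner {i : ZMod n} : InRun A B (i - 1) → IsInner (A i) (B i) → InRun A B i

section Runs

variable {A B : ZMod n → Cell} {i : ZMod n}

omit [NeZero n] in
theorem InRun.isFirst_or_isInner (h : InRun A B i) : IsFirst (A i) (B i) ∨ IsInner (A i) (B i) := by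
  cases h with
  | first h => exact .inl h
  | inner _ h => exact .inr h

omit [NeZero n] in
theorem inRun_add_one_iff : InRun A B (i + 1) ↔
    IsFirst (A (i + 1)) (B (i + 1)) ∨ IsInner (A (i + 1)) (B (i + 1)) ∧ InRun A B i := by
  constructor
  · rintro (h | ⟨h, hinner⟩)
    exacts [.inl h, .inr ⟨hinner, by rwa [add_sub_cancel_right] at h⟩]
  · rintro (h | ⟨hinner, h⟩)
    exacts [.first h, .inner (by rwa [add_sub_cancel_right]) hinner]

/-- A windowing with a first site, except that its only window is still open at the site `i`. -/
structure IsOpenWindowing (A B : ZMod n → Cell) (p : ZMod n → Position) (i : ZMod n) : Prop where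
  isOpen : p i = .first ∨ p i = .inner
  canPrecede : ∀ k ≠ i, (p k).CanPrecede (p (k + 1))
  admits : ∀ k, (p k).Admits (A k) (B k) (A (k + 1))
  ne_last : ∀ k, p k ≠ .last
  exists_first : ∃ k, p k = .first

omit [NeZero n] in
theorem InRun.exists_isOpenWindowing (h : InRun A B i) : ∃ p, IsOpenWindowing A B p i := by
  induction h with
  | @first i hi =>
    refine ⟨Function.update (fun _ => .outside) i .first, ?_, ?_, ?_, ?_, i, ?_⟩ <;>
      grind [Function.update_apply, Position.CanPrecede, Position.Admits]
  | @inner i _ hi ih =>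
    obtain ⟨p, hopen, hprec, hadm, hlast, k, hk⟩ := ih
    have hki : k ≠ i := by
      rintro rfl
      have hfirst := hadm k
      rw [hk] at hfirst
      exact IsInner.not_isFirst hi hfirst
    refine ⟨Function.update p i .inner, ?_, ?_, ?_, ?_, k, ?_⟩ <;>
      grind [Function.update_apply, Position.CanPrecede, Position.Admits]

omit [NeZero n] in
theorem InRun.exists_isWindowing (h : InRun A B (i - 1)) (hB : IsConfig B)
    (hi : IsLast (A i) (B i) (A (i + 1))) : ∃ p, IsWindowing A B p ∧ ∃ k, p k = .first := by
  obtain ⟨p, hopen, hprec, hadm, hlast, k, hk⟩ := h.exists_isOpenWindowing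
  have hki : k ≠ i := by
    rintro rfl
    have hfirst := hadm k
    rw [hk] at hfirst
    exact hi.not_isFirst hfirst
  have hnext : p (i + 1) ≠ .inner := by
    intro hinner
    have hadm_next := hadm (i + 1)
    rw [hinner] at hadm_next
    have hadm_i := hadm i
    cases hpi : p i with
    | outside =>
      have hprec_i := hprec i fun heq => by rw [← heq, hpi] at hopen; simp at hopen
      rw [hpi, hinner] at hprec_i
      revert hprec_i
      decide
    | first =>
      rw [hpi] at hadm_i
      exact hi.not_isFirst hadm_i
    | inner =>
      rw [hpi] at hadm_i
      exact hi.not_isInner_succ hadm_i (hB i) hadm_next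
    | last => exact hlast i hpi
  have hclosed : p (i + 1) = .outside ∨ p (i + 1) = .first := by
    cases hpi : p (i + 1) <;> simp_all
  refine ⟨Function.update p i .last, ⟨?_, ?_⟩, k, ?_⟩ <;>
      grind [Function.update_apply, Position.CanPrecede, Position.Admits]

end Runs

/-- A function of the states at one site and of the predicate `InRun` whose difference between
neighbouring sites bounds the local bracket from above, unless a window ends there. -/
def mixedPotential (r : Bool) (a a' : Cell) : ℤ :=
  (if r then 1 else 0) - (if IsFirst a a' then 1 else 0) +
    (if a = head ∧ a' = tail then 1 else 0) - (if a = tail ∧ a' = head then 1 else 0)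

set_option synthInstance.maxSize 1000 in
theorem localBracket_O_E_le : ∀ a b, Cell.CanPrecede a b → ∀ a' b', Cell.CanPrecede a' b' →
    ∀ r : Bool, (r = true → IsFirst a a' ∨ IsInner a a') → (IsFirst a a' → r = true) →
    ∀ r' : Bool, (r' = true ↔ IsFirst b b' ∨ IsInner b b' ∧ r = true) →
    (r = true → ¬(b = tail ∧ b' = empty)) → (r = true → IsInner a a' → ¬IsLast a a' b) →
    localBracket .O .E a a' b b' ≤ mixedPotential r' b b' - mixedPotential r a a' := by
  decide

theorem exists_isWindowing_of_pos {A B : ZMod n → Cell} (hA : IsConfig A) (hB : IsConfig B)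
    (h : 0 < ∑ i, localBracket .O .E (A i) (B i) (A (i + 1)) (B (i + 1))) :
    ∃ p, IsWindowing A B p ∧ ∃ k, p k = .first := by
  classical
  by_contra hno
  have hnot : ∀ i, InRun A B (i - 1) → ¬IsLast (A i) (B i) (A (i + 1)) :=
    fun i hrun hlast => hno (hrun.exists_isWindowing hB hlast)
  have hle : ∀ i, localBracket .O .E (A i) (B i) (A (i + 1)) (B (i + 1)) ≤
      mixedPotential (InRun A B (i + 1)) (A (i + 1)) (B (i + 1)) -
        mixedPotential (InRun A B i) (A i) (B i) := by
    intro i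
    refine localBracket_O_E_le _ _ (hA i) _ _ (hB i) _ ?_ ?_ _ ?_ ?_ ?_ <;>
      simp only [decide_eq_true_eq]
    · exact InRun.isFirst_or_isInner
    · exact .first
    · exact inRun_add_one_iff
    · exact fun hrun hlast => hnot (i + 1) (by rwa [add_sub_cancel_right]) (.inr hlast)
    · rintro (hfirst | ⟨hrun, -⟩) hinner
      exacts [absurd hfirst hinner.not_isFirst, hnot i hrun]
  have hsum := Finset.sum_le_sum fun i (_ : i ∈ Finset.univ) => hle i
  rw [Finset.sum_sub_distrib,
    sum_add_right (fun i => mixedPotential (InRun A B i) (A i) (B i)) 1, sub_self] at hsum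
  omega

end Windows

theorem IsGeneric.bracket_exponent_O_E_nonpos {q : Phase n} (hq : IsGeneric q)
    {A B : ZMod n → Cell} (hA : IsOptimal .O A q) (hB : IsOptimal .E B q) :
    bracket (exponent .O A) (exponent .E B) ≤ 0 := by
  rw [bracket_exponent]
  by_contra hpos
  obtain ⟨p, hp, k, hk⟩ := exists_isWindowing_of_pos hA.1 hB.1 (by exact_mod_cast not_le.1 hpos)
  have hconfig := hp.isConfig_exchange hA.1 hB.1
  have hcount := hp.numFactors_exchange hA.1 hB.1
  exact hp.exchange_ne hk (hq.eq_of_rearrangement hA hB hconfig.1 hconfig.2 hcount.1 hcount.2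
    hp.exponent_exchange)

theorem IsGeneric.bracket_exponent_O_E_eq_zero {q : Phase n} (hq : IsGeneric q)
    {A B : ZMod n → Cell} (hA : IsOptimal .O A q) (hB : IsOptimal .E B q) :
    bracket (exponent .O A) (exponent .E B) = 0 := by
  refine le_antisymm (hq.bracket_exponent_O_E_nonpos hA hB) ?_
  have hmirror := hq.mirror.bracket_exponent_O_E_nonpos hB.mirror hA.mirror
  have heqB := exponent_mirrorConfig .E B
  have heqA := exponent_mirrorConfig .O A
  simp only [Kind.swap] at heqA heqB
  rw [heqA, heqB, bracket_mirror_mirror, bracket_swap] at hmirror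
  linarith

theorem IsGeneric.bracket_exponent_eq_zero {q : Phase n} (hq : IsGeneric q) {τ τ' : Kind}
    {A B : ZMod n → Cell} (hA : IsOptimal τ A q) (hB : IsOptimal τ' B q) :
    bracket (exponent τ A) (exponent τ' B) = 0 := by
  cases τ <;> cases τ'
  · exact hq.bracket_exponent_O_eq_zero hA hB
  · exact hq.bracket_exponent_O_E_eq_zero hA hB
  · rw [bracket_swap, hq.bracket_exponent_O_E_eq_zero hB hA, neg_zero]
  · have hmirror := hq.mirror.bracket_exponent_O_eq_zero hA.mirror hB.mirror
    have heqA := exponent_mirrorConfig .E A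
    have heqB := exponent_mirrorConfig .E B
    simp only [Kind.swap] at heqA heqB
    rwa [heqA, heqB, bracket_mirror_mirror] at hmirror

/-! ### Factorizations of the complement of a monomial -/

/-- The pairs of states at one site of two configurations without common empty sites. -/
def IsComplementary : Cell → Cell → Prop
  | empty, b => b ≠ empty
  | short, b => b = empty
  | head, b => b = empty ∨ b = tail
  | tail, b => b = empty ∨ b = head

instance : DecidableRel IsComplementary := fun a b => by
  cases a <;> simp only [IsComplementary] <;> infer_instance

/-- The state at a site of the product of two monomials of kind `O` without common empty sites,
divided by all `x_i`, as a monomial of kind `E`; `a, a'` and `b, b'` are the states at the site and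
at the following one. -/
def mergeCell : Cell → Cell → Cell → Cell → Cell
  | head, tail, _, _ | tail, head, _, _ => tail
  | _, _, head, tail | _, _, tail, head => head
  | head, _, _, _ | _, head, _, _ => short
  | _, _, _, _ => empty

theorem isComplementary_of_not_empty : ∀ b b', ¬(b = empty ∧ b' = empty) → ∀ a, CanPrecede a b →
    ∀ a', CanPrecede a' b' → ¬(a = empty ∧ a' = empty) → ∀ c, CanPrecede b c →
    ∀ c', CanPrecede b' c' → ¬(c = empty ∧ c' = empty) → IsComplementary b b' := by
  decide

theorem canPrecede_mergeCell : ∀ a a', IsComplementary a a' → ∀ b b', IsComplementary b b' →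
    CanPrecede a b → CanPrecede a' b' → ∀ c c', IsComplementary c c' → CanPrecede b c →
    CanPrecede b' c' → CanPrecede (mergeCell a a' b b') (mergeCell b b' c c') := by
  decide

theorem exp_add_exp_eq_mergeCell : ∀ a a', IsComplementary a a' → ∀ b b', IsComplementary b b' →
    CanPrecede a b → CanPrecede a' b' →
    expX .O a + expX .O a' = 1 + expX .E (mergeCell a a' b b') ∧
      expY .O a + expY .O a' = expY .E (mergeCell a a' b b') := by
  decide

theorem startInd_mergeCell : ∀ a a', IsComplementary a a' → ∀ b b', IsComplementary b b' →
    CanPrecede a b → CanPrecede a' b' →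
    startInd a + startInd a' + startInd (mergeCell a a' b b') =
      1 + (headInd a - tailInd a) + (headInd a' - tailInd a') := by
  decide

theorem headInd_eq : ∀ a : Cell, headInd a = if a = head then 1 else 0 := by decide

theorem tailInd_eq : ∀ a : Cell, tailInd a = if a = tail then 1 else 0 := by decide

theorem IsConfig.sum_headInd_sub_tailInd {S : ZMod n → Cell} (hS : IsConfig S) :
    ∑ i, (headInd (S i) - tailInd (S i)) = 0 := by
  simp only [Finset.sum_sub_distrib, headInd_eq, tailInd_eq, hS.sum_tail, sub_self]

omit [NeZero n] in
theorem exponent_O_add_exponent_O_eq {A B C : ZMod n → Cell}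
    (h : ∀ i, expX .O (A i) + expX .O (B i) = 1 + expX .E (C i) ∧
      expY .O (A i) + expY .O (B i) = expY .E (C i)) :
    exponent .O A + exponent .O B = total .O + exponent .E C := by
  ext i
  · simpa [exponent, total] using mod_cast (h i).1
  · simpa [exponent, total] using mod_cast (h i).2

theorem exists_product_O {A B : ZMod n → Cell} (hA : IsConfig A) (hB : IsConfig B)
    (hno : ∀ i, ¬CommonEmpty A B i) :
    ∃ C : ZMod n → Cell, IsConfig C ∧ numFactors C + 2 * numFactors A = n ∧
      exponent .O A + exponent .O B = total .O + exponent .E C := by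
  have hcompl (i) : IsComplementary (A i) (B i) :=
    isComplementary_of_not_empty _ _ (hno i) _ (hA.pred i) _ (hB.pred i) (hno _) _ (hA i) _ (hB i)
      (hno _)
  refine ⟨fun i => mergeCell (A i) (B i) (A (i + 1)) (B (i + 1)), fun i =>
    canPrecede_mergeCell _ _ (hcompl i) _ _ (hcompl _) (hA i) (hB i) _ _ (hcompl _) (hA _) (hB _),
    ?_, exponent_O_add_exponent_O_eq fun i =>
      exp_add_exp_eq_mergeCell _ _ (hcompl i) _ _ (hcompl _) (hA i) (hB i)⟩
  have hsum := Finset.sum_congr (s₁ := Finset.univ) rfl fun i _ =>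
    startInd_mergeCell _ _ (hcompl i) _ _ (hcompl _) (hA i) (hB i)
  simp only [Finset.sum_add_distrib, hA.sum_headInd_sub_tailInd, hB.sum_headInd_sub_tailInd,
    Finset.sum_const, Finset.card_univ, ZMod.card, nsmul_eq_mul, mul_one] at hsum
  have hcount := (numFactors_eq_of_no_commonEmpty hA hB hno).1
  simp only [numFactors] at hcount ⊢
  linarith

/-- Whether, in the complement of a monomial of kind `E`, a factor of kind `O` starts at a site with
state `b` behind a site with state `a`. -/
def opensFactor (a b : Cell) : Bool := b ≠ empty ∨ a = empty

/-- The state at a site of the monomial formed by the factors of the colour `γ`; the factors at the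
preceding site and at the site itself that start last have the colours `c` and `d`. -/
def colourCell (γ : Bool) (a b : Cell) (c d : Bool) : Cell :=
  if a ≠ empty ∧ c = γ then tail
  else if opensFactor a b ∧ d = γ then (if b ≠ empty then head else short) else empty

theorem canPrecede_colourCell : ∀ (γ c : Bool) (x y z : Cell), CanPrecede x y → CanPrecede y z →
    CanPrecede (colourCell γ x y c (c ^^ opensFactor x y))
      (colourCell γ y z (c ^^ opensFactor x y) (c ^^ opensFactor x y ^^ opensFactor y z)) := by
  decide

theorem exp_colourCell_add : ∀ (c : Bool) (x y : Cell), CanPrecede x y →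
    expX .O (colourCell true x y c (c ^^ opensFactor x y)) +
        expX .O (colourCell false x y c (c ^^ opensFactor x y)) = 1 + expX .E y ∧
      expY .O (colourCell true x y c (c ^^ opensFactor x y)) +
        expY .O (colourCell false x y c (c ^^ opensFactor x y)) = expY .E y := by
  decide

theorem colourCell_ne : ∀ (c : Bool) (x y : Cell), CanPrecede x y →
    colourCell true x y c (c ^^ opensFactor x y) ≠
      colourCell false x y c (c ^^ opensFactor x y) := by
  decide

theorem startInd_colourCell_add : ∀ (c : Bool) (x y : Cell), CanPrecede x y →
    startInd (colourCell true x y c (c ^^ opensFactor x y)) +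
      startInd (colourCell false x y c (c ^^ opensFactor x y)) =
        if opensFactor x y then 1 else 0 := by
  decide

theorem opensFactor_add_startInd : ∀ a b, CanPrecede a b →
    ((if opensFactor a b then 1 else 0) + startInd a + (tailInd a - headInd a) : ℤ) = 1 := by
  decide

theorem sum_opensFactor {C : ZMod n → Cell} (hC : IsConfig C) :
    (∑ i, if opensFactor (C (i - 1)) (C i) then 1 else 0) + numFactors C = n := by
  have hsum := Finset.sum_congr (s₁ := Finset.univ) rfl fun i _ =>
    opensFactor_add_startInd _ _ (hC i)
  have hbalance := hC.sum_headInd_sub_tailInd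
  rw [← sum_add_right _ 1]
  simp only [add_sub_cancel_right, Finset.sum_add_distrib, Finset.sum_sub_distrib, Finset.sum_const,
    Finset.card_univ, ZMod.card, nsmul_eq_mul, mul_one] at hsum hbalance ⊢
  rw [numFactors]
  linarith

/-- The colour of the last factor of the complement that starts at or before the site: the factors
are coloured alternately, beginning at the site `0`. -/
def factorColour (C : ZMod n → Cell) (i : ZMod n) : Bool :=
  Odd (∑ t ∈ Finset.range (i.val + 1), if opensFactor (C (t - 1)) (C t) then 1 else 0)

section Colouring

variable {C : ZMod n → Cell} (hC : IsConfig C) {k : ℤ} (hk : numFactors C + 2 * k = n)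

include hC hk

theorem factorColour_add_one (i : ZMod n) :
    factorColour C (i + 1) = (factorColour C i ^^ opensFactor (C i) (C (i + 1))) := by
  unfold factorColour
  rcases val_add_one_cases i with ⟨h, -⟩ | ⟨h₀, hlast⟩
  · rw [h, Finset.sum_range_succ]
    simp only [Nat.cast_add, ZMod.natCast_val, ZMod.cast_id', id_eq, Nat.cast_one,
      add_sub_cancel_right]
    cases opensFactor (C i) (C (i + 1)) <;> simp [Nat.odd_add_one, -Finset.sum_boole,
      -Nat.not_odd_iff_even]
  · have hzero : i + 1 = 0 := (ZMod.val_eq_zero _).1 h₀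
    have hi : i = -1 := by linear_combination hzero
    have heven : ¬Odd (∑ t ∈ Finset.range n,
        if opensFactor (C ((t : ZMod n) - 1)) (C t) then 1 else 0) := by
      have hsum := sum_opensFactor hC
      rw [sum_eq_sum_range _ 0] at hsum
      rw [Nat.not_odd_iff_even, ← Int.even_coe_nat, even_iff_two_dvd]
      push_cast
      simp only [zero_add] at hsum
      exact ⟨k, by linarith⟩
    rw [h₀, hlast, hzero, hi]
    cases h : opensFactor (C (-1)) (C 0) <;> simp [heven, h, -Finset.sum_boole]

theorem factorColour_eq (i : ZMod n) :
    factorColour C i = (factorColour C (i - 1) ^^ opensFactor (C (i - 1)) (C i)) := by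
  simpa using factorColour_add_one hC hk (i - 1)

theorem isConfig_colourCell (γ : Bool) : IsConfig fun i =>
    colourCell γ (C (i - 1)) (C i) (factorColour C (i - 1)) (factorColour C i) := by
  intro i
  have h := canPrecede_colourCell γ (factorColour C (i - 1)) _ _ _ (hC.pred i) (hC i)
  rw [← factorColour_eq hC hk, ← factorColour_add_one hC hk] at h
  simpa using h

/-- The complement of a monomial of kind `E` is a cyclic sequence of overlapping factors of kind
`O`; as their number is even, they can be coloured alternately. -/
theorem exists_factorization_O : ∃ A B : ZMod n → Cell, IsConfig A ∧ IsConfig B ∧ A ≠ B ∧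
    numFactors A = k ∧ numFactors B = k ∧
    exponent .O A + exponent .O B = total .O + exponent .E C := by
  let part (γ : Bool) (i : ZMod n) : Cell :=
    colourCell γ (C (i - 1)) (C i) (factorColour C (i - 1)) (factorColour C i)
  have hpart (γ) : IsConfig (part γ) := isConfig_colourCell hC hk γ
  have hne (i) : part true i ≠ part false i := by
    simpa only [part, factorColour_eq hC hk i] using colourCell_ne _ _ _ (hC.pred i)
  have hcount : numFactors (part true) = numFactors (part false) :=
    (numFactors_eq_of_no_commonEmpty (hpart true) (hpart false) fun i hi =>
      hne i (hi.1.trans hi.2.symm)).1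
  have hsum : numFactors (part true) + numFactors (part false) = 2 * k := by
    have hopens : numFactors (part true) + numFactors (part false) =
        ∑ i, if opensFactor (C (i - 1)) (C i) then 1 else 0 := by
      rw [numFactors, numFactors, ← Finset.sum_add_distrib]
      refine Finset.sum_congr rfl fun i _ => ?_
      simpa only [part, factorColour_eq hC hk i] using
        startInd_colourCell_add _ _ _ (hC.pred i)
    linarith [sum_opensFactor hC]
  refine ⟨part true, part false, hpart true, hpart false, fun h => hne 0 (congrFun h 0), by omega,
    by omega, exponent_O_add_exponent_O_eq fun i => ?_⟩
  simpa only [part, factorColour_eq hC hk i] using exp_colourCell_add _ _ _ (hC.pred i)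

end Colouring

omit [NeZero n] in
theorem exponent_eq_mirror (τ : Kind) (S : ZMod n → Cell) :
    exponent τ S = mirror (exponent τ.swap (mirrorConfig S)) := by
  rw [exponent_mirrorConfig, mirror_mirror]

theorem reverse_eq_empty_iff : ∀ {a : Cell}, a.reverse = empty ↔ a = empty := by decide

omit [NeZero n] in
theorem commonEmpty_mirrorConfig {A B : ZMod n → Cell} {i : ZMod n} :
    CommonEmpty (mirrorConfig A) (mirrorConfig B) i ↔ CommonEmpty A B (-i) := by
  simp only [CommonEmpty, mirrorConfig, reverse_eq_empty_iff]

omit [NeZero n] in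
theorem mirrorConfig_injective :
    Function.Injective (mirrorConfig : (ZMod n → Cell) → ZMod n → Cell) :=
  Function.LeftInverse.injective mirrorConfig_mirrorConfig

theorem exists_product (τ : Kind) {A B : ZMod n → Cell} (hA : IsConfig A) (hB : IsConfig B)
    (hno : ∀ i, ¬CommonEmpty A B i) :
    ∃ C : ZMod n → Cell, IsConfig C ∧ numFactors C + 2 * numFactors A = n ∧
      exponent τ A + exponent τ B = total τ + exponent τ.swap C := by
  cases τ
  · exact exists_product_O hA hB hno
  · obtain ⟨C, hC, hcount, hsum⟩ := exists_product_O hA.mirrorConfig hB.mirrorConfig fun i hi =>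
      hno _ (commonEmpty_mirrorConfig.1 hi)
    refine ⟨mirrorConfig C, hC.mirrorConfig, by
      rw [hC.numFactors_mirrorConfig, ← hcount, hA.numFactors_mirrorConfig], ?_⟩
    rw [exponent_eq_mirror .E A, exponent_eq_mirror .E B, ← map_add]
    exact (congrArg mirror hsum).trans (by
      rw [map_add, mirror_total, ← exponent_mirrorConfig]; rfl)

theorem exists_factorization (τ : Kind) {C : ZMod n → Cell} (hC : IsConfig C) {k : ℤ}
    (hk : numFactors C + 2 * k = n) :
    ∃ A B : ZMod n → Cell, IsConfig A ∧ IsConfig B ∧ A ≠ B ∧ numFactors A = k ∧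
      numFactors B = k ∧ exponent τ A + exponent τ B = total τ + exponent τ.swap C := by
  cases τ
  · exact exists_factorization_O hC hk
  · obtain ⟨A, B, hA, hB, hne, hcountA, hcountB, hsum⟩ :=
      exists_factorization_O hC.mirrorConfig (hC.numFactors_mirrorConfig.symm ▸ hk)
    refine ⟨mirrorConfig A, mirrorConfig B, hA.mirrorConfig, hB.mirrorConfig,
      mirrorConfig_injective.ne hne, hA.numFactors_mirrorConfig.trans hcountA,
      hB.numFactors_mirrorConfig.trans hcountB, ?_⟩
    calc exponent .E (mirrorConfig A) + exponent .E (mirrorConfig B)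
        = mirror (exponent .O A + exponent .O B) := by
          rw [map_add, ← exponent_mirrorConfig, ← exponent_mirrorConfig]; rfl
      _ = total .E + exponent .O C := by
          rw [hsum, map_add, mirror_total, exponent_eq_mirror .O C]; rfl

theorem exists_rearrangement (τ : Kind) {A B : ZMod n → Cell} (hA : IsConfig A) (hB : IsConfig B)
    (hcount : numFactors A = numFactors B) (hne : A ≠ B) :
    (∃ C : ZMod n → Cell, IsConfig C ∧ numFactors C + 2 * numFactors A = n ∧
      exponent τ A + exponent τ B = total τ + exponent τ.swap C) ∨
    (∃ C D : ZMod n → Cell, IsConfig C ∧ IsConfig D ∧ numFactors C = numFactors A + 1 ∧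
      numFactors D = numFactors A - 1 ∧
      exponent τ C + exponent τ D = exponent τ A + exponent τ B) ∨
    ∃ C D : ZMod n → Cell, IsConfig C ∧ IsConfig D ∧ numFactors C = numFactors A ∧
      numFactors D = numFactors A ∧ C ≠ A ∧
      exponent τ C + exponent τ D = exponent τ A + exponent τ B ∧
      ∀ c : ℝ, exponent τ B - exponent τ A = c • (exponent τ C - exponent τ A) →
        bracket (exponent τ A) (exponent τ B) ≠ 0 := by
  by_cases hno : ∀ i, ¬CommonEmpty A B i
  · exact .inl (exists_product τ hA hB hno)
  push Not at hno
  obtain ⟨i, hi⟩ := hno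
  right
  cases τ
  · refine (exists_rearrangement_of_commonEmpty hA hB hcount hne ⟨i, hi⟩).imp ?_ ?_
    · exact fun ⟨C, D, hC, hD, hcountC, hcountD, hsum⟩ => ⟨C, D, hC, hD, hcountC, hcountD, hsum _⟩
    · exact fun ⟨C, D, hC, hD, hcountC, hcountD, hCA, hsum, hline⟩ =>
        ⟨C, D, hC, hD, hcountC, hcountD, hCA, hsum _, hline⟩
  have hswap (S : ZMod n → Cell) : exponent .E S = mirror (exponent .O (mirrorConfig S)) :=
    exponent_eq_mirror .E S
  refine (exists_rearrangement_of_commonEmpty hA.mirrorConfig hB.mirrorConfig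
    (by rw [hA.numFactors_mirrorConfig, hB.numFactors_mirrorConfig, hcount])
    (mirrorConfig_injective.ne hne)
    ⟨-i, commonEmpty_mirrorConfig.2 (by rwa [neg_neg])⟩).imp ?_ ?_
  · rintro ⟨C, D, hC, hD, hcountC, hcountD, hsum⟩
    refine ⟨mirrorConfig C, mirrorConfig D, hC.mirrorConfig, hD.mirrorConfig,
      by rw [hC.numFactors_mirrorConfig, hcountC, hA.numFactors_mirrorConfig],
      by rw [hD.numFactors_mirrorConfig, hcountD, hA.numFactors_mirrorConfig], ?_⟩
    simp only [hswap, mirrorConfig_mirrorConfig, ← map_add, hsum]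
  · rintro ⟨C, D, hC, hD, hcountC, hcountD, hCA, hsum, hline⟩
    refine ⟨mirrorConfig C, mirrorConfig D, hC.mirrorConfig, hD.mirrorConfig,
      by rw [hC.numFactors_mirrorConfig, hcountC, hA.numFactors_mirrorConfig],
      by rw [hD.numFactors_mirrorConfig, hcountD, hA.numFactors_mirrorConfig],
      fun h => hCA (by rw [← h, mirrorConfig_mirrorConfig]), ?_, fun c hc => ?_⟩
    · simp only [hswap, mirrorConfig_mirrorConfig, ← map_add, hsum]
    · simp only [hswap, mirrorConfig_mirrorConfig, ← map_sub, ← map_smul] at hc ⊢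
      rw [bracket_mirror_mirror]
      exact hline c ((mirror_mirror _).symm.trans ((congrArg mirror hc).trans (mirror_mirror _)))

/-! ### Selections of optimal monomials -/

set_option synthInstance.maxSize 1000 in
set_option maxRecDepth 10000 in
theorem eq_of_exp_eq : ∀ τ : Kind, ∀ b b', expX τ b = expX τ b' → expY τ b = expY τ b' →
    ∀ a, CanPrecede a b → ∀ a', CanPrecede a' b' → expX τ a = expX τ a' → expY τ a = expY τ a' →
    ∀ c, CanPrecede b c → ∀ c', CanPrecede b' c' → expX τ c = expX τ c' → expY τ c = expY τ c' →
    b = b' := by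
  decide

omit [NeZero n] in
theorem exponent_injective (τ : Kind) {S S' : ZMod n → Cell} (hS : IsConfig S)
    (hS' : IsConfig S') (h : exponent τ S = exponent τ S') : S = S' := by
  have hX (i) : expX τ (S i) = expX τ (S' i) :=
    Int.cast_injective (congrFun (congrArg Prod.fst h) i)
  have hY (i) : expY τ (S i) = expY τ (S' i) :=
    Int.cast_injective (congrFun (congrArg Prod.snd h) i)
  funext i
  exact eq_of_exp_eq τ _ _ (hX i) (hY i) _ (hS.pred i) _ (hS'.pred i) (hX _) (hY _) _ (hS i) _
    (hS' i) (hX _) (hY _)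

theorem IsConfig.exponent_eq_zero (τ : Kind) {S : ZMod n → Cell} (hS : IsConfig S)
    (h : numFactors S = 0) : exponent τ S = 0 := by
  have hstart (i) : startInd (S i) = 0 :=
    (Finset.sum_eq_zero_iff_of_nonneg fun i _ => startInd_nonneg (S i)).1 h i (Finset.mem_univ i)
  have hlocal : ∀ a b, startInd a = 0 → startInd b = 0 → CanPrecede a b → b = empty := by decide
  have hempty (i) : S i = empty := hlocal _ _ (hstart _) (hstart _) (hS.pred i)
  cases τ <;> ext i <;> simp [exponent, hempty, expX, expY, occInd, headInd, tailInd]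

theorem IsConfig.exists_index {S : ZMod n → Cell} (hS : IsConfig S) :
    ∃ k : Fin (n / 2 + 1), numFactors S = (k : ℕ) := by
  have hle := hS.two_mul_numFactors_le
  have hnonneg := numFactors_nonneg S
  exact ⟨⟨(numFactors S).toNat, by omega⟩, (Int.toNat_of_nonneg hnonneg).symm⟩

/-- The differences of the exponent vectors of two monomials of the same kind and length. -/
def exponentDiffs (n : ℕ) [NeZero n] : Set (Phase n) :=
  {f | ∃ (τ : Kind) (S S' : ZMod n → Cell), IsConfig S ∧ IsConfig S' ∧
    numFactors S = numFactors S' ∧ f = exponent τ S - exponent τ S'}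

theorem finite_exponentDiffs : (exponentDiffs n).Finite := by
  refine (Set.finite_range fun x : Kind × (ZMod n → Cell) × (ZMod n → Cell) =>
    exponent x.1 x.2.1 - exponent x.1 x.2.2).subset ?_
  rintro f ⟨τ, S, S', -, -, -, rfl⟩
  exact ⟨(τ, S, S'), rfl⟩

theorem sub_mem_exponentDiffs (τ : Kind) {S S' : ZMod n → Cell} (hS : IsConfig S)
    (hS' : IsConfig S') (h : numFactors S = numFactors S') :
    exponent τ S - exponent τ S' ∈ exponentDiffs n := ⟨τ, S, S', hS, hS', h, rfl⟩

theorem neg_mem_exponentDiffs {f : Phase n} (hf : f ∈ exponentDiffs n) :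
    -f ∈ exponentDiffs n := by
  obtain ⟨τ, S, S', hS, hS', hcount, rfl⟩ := hf
  exact ⟨τ, S', S, hS', hS, hcount.symm, neg_sub _ _⟩

theorem isGeneric_iff {q : Phase n} :
    IsGeneric q ↔ ∀ f ∈ exponentDiffs n, f ≠ 0 → dot f q ≠ 0 := by
  constructor
  · rintro h f ⟨τ, S, S', hS, hS', hcount, rfl⟩ hf hdot
    rw [map_sub, LinearMap.sub_apply, sub_eq_zero] at hdot
    rw [h τ S S' hS hS' hcount hdot, sub_self] at hf
    exact hf rfl
  · intro h τ S S' hS hS' hcount hdot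
    by_contra hne
    refine h _ (sub_mem_exponentDiffs τ hS hS' hcount) (fun hzero => hne ?_) ?_
    · exact exponent_injective τ hS hS' (sub_eq_zero.1 hzero)
    · rw [map_sub, LinearMap.sub_apply, hdot, sub_self]

theorem isOptimal_iff {τ : Kind} {S : ZMod n → Cell} {q : Phase n} : IsOptimal τ S q ↔
    IsConfig S ∧ ∀ S', IsConfig S' → numFactors S' = numFactors S →
      0 ≤ dot (exponent τ S - exponent τ S') q := by
  simp only [IsOptimal, map_sub, LinearMap.sub_apply, sub_nonneg]

/-- The point `q` lies so close to `q₀` that no difference of exponent vectors that is positive at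
`q₀` loses its positivity. -/
def IsNear (q₀ q : Phase n) : Prop := ∀ f ∈ exponentDiffs n, 0 < dot f q₀ → 0 < dot f q

theorem IsOptimal.of_isNear {τ : Kind} {S : ZMod n → Cell} {q q₀ : Phase n}
    (h : IsOptimal τ S q) (hnear : IsNear q₀ q) : IsOptimal τ S q₀ := by
  rw [isOptimal_iff] at h ⊢
  refine ⟨h.1, fun S' hS' hcount => ?_⟩
  by_contra! hneg
  have hpos := hnear _ (neg_mem_exponentDiffs (sub_mem_exponentDiffs τ h.1 hS' hcount.symm))
    (by simpa using hneg)
  rw [map_neg, LinearMap.neg_apply] at hpos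
  linarith [h.2 S' hS' hcount]

theorem IsOptimal.dot_eq {τ : Kind} {S S' : ZMod n → Cell} {q : Phase n} (h : IsOptimal τ S q)
    (h' : IsOptimal τ S' q) (hcount : numFactors S = numFactors S') :
    dot (exponent τ S) q = dot (exponent τ S') q :=
  le_antisymm (h'.2 S h.1 hcount) (h.2 S' h'.1 hcount.symm)

theorem IsOptimal.eq_of_exponent_add {q : Phase n} (hq : IsGeneric q) {τ : Kind}
    {S A B : ZMod n → Cell} (hS : IsOptimal τ S q) (hA : IsConfig A) (hB : IsConfig B)
    (hcountA : numFactors A = numFactors S) (hcountB : numFactors B = numFactors S)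
    (h : exponent τ A + exponent τ B = (2 : ℝ) • exponent τ S) : A = B := by
  have hleA := hS.2 A hA hcountA
  have hleB := hS.2 B hB hcountB
  have hsum := congrArg (fun v => dot v q) h
  simp only [map_add, map_smul, LinearMap.add_apply, LinearMap.smul_apply, smul_eq_mul] at hsum
  exact hq τ A B hA hB (hcountA.trans hcountB.symm) (by linarith)

/-- A choice of a configuration for each kind and each number of factors. -/
abbrev Selection (n : ℕ) : Type := Kind → Fin (n / 2 + 1) → ZMod n → Cell

/-- The chosen configurations have the right number of factors and are optimal at `q`. -/
def IsSelection (s : Selection n) (q : Phase n) : Prop :=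
  ∀ τ k, IsOptimal τ (s τ k) q ∧ numFactors (s τ k) = (k : ℕ)

theorem exists_isSelection (q : Phase n) : ∃ s : Selection n, IsSelection s q := by
  choose s hs using fun (τ : Kind) (k : Fin (n / 2 + 1)) =>
    exists_isOptimal τ q (k := (k : ℕ)) (Nat.lt_succ_iff.1 k.2)
  exact ⟨s, hs⟩

theorem IsSelection.of_isNear {s : Selection n} {q q₀ : Phase n} (h : IsSelection s q)
    (hnear : IsNear q₀ q) : IsSelection s q₀ :=
  fun τ k => ⟨(h τ k).1.of_isNear hnear, (h τ k).2⟩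

theorem IsSelection.numFactors_eq {s₁ s₂ : Selection n} {q₁ q₂ : Phase n}
    (h₁ : IsSelection s₁ q₁) (h₂ : IsSelection s₂ q₂) (τ : Kind) (k : Fin (n / 2 + 1)) :
    numFactors (s₁ τ k) = numFactors (s₂ τ k) := by
  rw [(h₁ τ k).2, (h₂ τ k).2]

theorem IsSelection.dot_eq {s₁ s₂ : Selection n} {q : Phase n} (h₁ : IsSelection s₁ q)
    (h₂ : IsSelection s₂ q) (τ : Kind) (k : Fin (n / 2 + 1)) :
    dot (exponent τ (s₁ τ k)) q = dot (exponent τ (s₂ τ k)) q :=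
  (h₁ τ k).1.dot_eq (h₂ τ k).1 (h₁.numFactors_eq h₂ τ k)

theorem IsSelection.dot_le {s : Selection n} {q : Phase n} (h : IsSelection s q) (τ : Kind)
    (k : Fin (n / 2 + 1)) {S : ZMod n → Cell} (hS : IsConfig S) (hcount : numFactors S = (k : ℕ)) :
    dot (exponent τ S) q ≤ dot (exponent τ (s τ k)) q :=
  (h τ k).1.2 S hS (hcount.trans (h τ k).2.symm)

/-- The exponent vectors of the linear functions that agree near a generic point with the sums of
the coordinates, stored at index `0`, and with the tropical invariants. -/
noncomputable def vec (s : Selection n) (i : Kind × Fin (n / 2 + 1)) : Phase n :=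
  if i.2 = 0 then total i.1 else exponent i.1 (s i.1 i.2)

theorem IsGeneric.bracket_vec {q : Phase n} (hq : IsGeneric q) {s : Selection n}
    (hs : IsSelection s q) {τ : Kind} {A : ZMod n → Cell} (hA : IsOptimal τ A q)
    (i : Kind × Fin (n / 2 + 1)) : bracket (exponent τ A) (vec s i) = 0 := by
  unfold vec
  split_ifs
  · exact bracket_total _ _
  · exact hq.bracket_exponent_eq_zero hA (hs _ _).1

/-! ### Wall crossing -/

section LinearAlgebra

variable {K ι V : Type*} [Field K] [Finite ι] [AddCommGroup V] [Module K V] {M N : ι → V}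

theorem eq_zero_of_zero_prod_mem_span (hM : LinearIndependent K M) {v : V}
    (h : (0, v) ∈ Submodule.span K (Set.range fun i => (M i, N i))) : v = 0 := by
  cases nonempty_fintype ι
  obtain ⟨a, ha⟩ := (Submodule.mem_span_range_iff_exists_fun K).1 h
  have hfst : ∑ i, a i • M i = 0 := by simpa [Prod.fst_sum] using congrArg Prod.fst ha
  have hsnd : ∑ i, a i • N i = v := by simpa [Prod.snd_sum] using congrArg Prod.snd ha
  simp [← hsnd, Fintype.linearIndependent_iff.1 hM a hfst]

theorem linearIndependent_of_prod_notMem_span (hM : LinearIndependent K M) {g : V} {c : ι → K}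
    (hN : ∀ i, N i = M i + c i • g)
    (hg : (g, 0) ∉ Submodule.span K (Set.range fun i => (M i, N i))) :
    LinearIndependent K N := by
  cases nonempty_fintype ι
  rw [Fintype.linearIndependent_iff] at hM ⊢
  intro a ha
  have hsplit : ∑ i, a i • M i + (∑ i, a i * c i) • g = 0 := by
    simpa only [hN, smul_add, Finset.sum_add_distrib, smul_smul, ← Finset.sum_smul] using ha
  by_cases hzero : ∑ i, a i * c i = 0
  · exact hM a (by rwa [hzero, zero_smul, add_zero] at hsplit)
  refine absurd ?_ hg
  have hmem : ∑ i, a i • (M i, N i) ∈ Submodule.span K (Set.range fun i => (M i, N i)) :=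
    Submodule.sum_mem _ fun i _ => Submodule.smul_mem _ _ (Submodule.subset_span ⟨i, rfl⟩)
  have hsum : ∑ i, a i • (M i, N i) = -(∑ i, a i * c i) • (g, 0) := by
    ext
    · simpa [Prod.fst_sum] using eq_neg_of_add_eq_zero_left hsplit
    · simpa [Prod.snd_sum] using ha
  rwa [hsum, Submodule.smul_mem_iff _ (neg_ne_zero.2 hzero)] at hmem

end LinearAlgebra

/-- Every difference of exponent vectors that vanishes at `q₀` is a multiple of `g`, so that `q₀`
lies on no other wall than the one orthogonal to `g`. -/
def IsWall (g q₀ : Phase n) : Prop := ∀ f ∈ exponentDiffs n, dot f q₀ = 0 → ∃ c : ℝ, f = c • g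

theorem IsWall.exists_exponent_eq {g q₀ : Phase n} (h : IsWall g q₀) {s : Selection n}
    (hs : IsSelection s q₀) {τ : Kind} {k : Fin (n / 2 + 1)} {S : ZMod n → Cell}
    (hS : IsConfig S) (hcount : numFactors S = (k : ℕ))
    (hdot : dot (exponent τ (s τ k)) q₀ ≤ dot (exponent τ S) q₀) :
    ∃ c : ℝ, exponent τ S = exponent τ (s τ k) + c • g := by
  obtain ⟨c, hc⟩ := h _ (sub_mem_exponentDiffs τ hS (hs τ k).1.1 (hcount.trans (hs τ k).2.symm))
    (by rw [map_sub, LinearMap.sub_apply, sub_eq_zero]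
        exact (hs.dot_le τ k hS hcount).antisymm hdot)
  exact ⟨c, by rw [← hc, add_sub_cancel]⟩

/-- The selections `s₁` and `s₂` are both optimal at the point `q₀` of a wall orthogonal to `g`. -/
structure IsCrossing (g q₀ : Phase n) (s₁ s₂ : Selection n) : Prop where
  isWall : IsWall g q₀
  left : IsSelection s₁ q₀
  right : IsSelection s₂ q₀

/-- The span of the pairs of corresponding vectors of two selections. -/
def pairSpan (s₁ s₂ : Selection n) : Submodule ℝ (Phase n × Phase n) :=
  Submodule.span ℝ (Set.range fun i => (vec s₁ i, vec s₂ i))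

omit [NeZero n] in
theorem total_mem_pairSpan (s₁ s₂ : Selection n) (τ : Kind) :
    (total τ, total τ) ∈ pairSpan s₁ s₂ :=
  Submodule.subset_span ⟨(τ, 0), by simp [vec]⟩

theorem IsSelection.exponent_zero {s : Selection n} {q : Phase n} (h : IsSelection s q)
    (τ : Kind) : exponent τ (s τ 0) = 0 :=
  (h τ 0).1.1.exponent_eq_zero τ (h τ 0).2

namespace IsCrossing

variable {g q₀ : Phase n} {s₁ s₂ : Selection n} (h : IsCrossing g q₀ s₁ s₂)

include h

theorem exponent_mem_pairSpan (τ : Kind) (k : Fin (n / 2 + 1)) :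
    (exponent τ (s₁ τ k), exponent τ (s₂ τ k)) ∈ pairSpan s₁ s₂ := by
  by_cases hk : k = 0
  · rw [hk, h.left.exponent_zero, h.right.exponent_zero]
    exact Submodule.zero_mem _
  · exact Submodule.subset_span ⟨(τ, k), by simp [vec, hk]⟩

theorem exists_exponent_eq (τ : Kind) (k : Fin (n / 2 + 1)) :
    ∃ c : ℝ, exponent τ (s₂ τ k) = exponent τ (s₁ τ k) + c • g :=
  h.isWall.exists_exponent_eq h.left (h.right τ k).1.1 (h.right τ k).2
    (h.left.dot_eq h.right τ k).le

theorem exists_vec_eq (i : Kind × Fin (n / 2 + 1)) : ∃ c : ℝ, vec s₂ i = vec s₁ i + c • g := by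
  unfold vec
  split_ifs
  · exact ⟨0, by rw [zero_smul, add_zero]⟩
  · exact h.exists_exponent_eq _ _

/-- If `U₂` is the exponent vector of a product of two different monomials competing with the
selected one, then `U₂ ≠ 2 • exponent τ (s₂ τ k)` by genericity, while the corresponding
difference for `s₁` is a multiple of `g`. -/
theorem notMem_pairSpan_of_product {q₂ : Phase n} (hq₂ : IsGeneric q₂)
    (hs₂ : IsSelection s₂ q₂) (hindep : LinearIndependent ℝ (vec s₁)) {τ : Kind}
    {k : Fin (n / 2 + 1)} {A B : ZMod n → Cell} (hA : IsConfig A) (hB : IsConfig B) (hne : A ≠ B)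
    (hcountA : numFactors A = (k : ℕ)) (hcountB : numFactors B = (k : ℕ)) {U₁ U₂ : Phase n}
    (hU : (U₁, U₂) ∈ pairSpan s₁ s₂) (hU₂ : exponent τ A + exponent τ B = U₂) {d : ℝ}
    (hU₁ : exponent τ (s₁ τ k) + exponent τ (s₂ τ k) = U₁ + d • g) :
    (g, 0) ∉ pairSpan s₁ s₂ := by
  intro hg
  obtain ⟨c, hc⟩ := h.exists_exponent_eq τ k
  have hmem := (pairSpan s₁ s₂).sub_mem ((pairSpan s₁ s₂).sub_mem hU
    ((pairSpan s₁ s₂).smul_mem (2 : ℝ) (h.exponent_mem_pairSpan τ k)))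
    ((pairSpan s₁ s₂).smul_mem (c - d) hg)
  have hfst : U₁ - (2 : ℝ) • exponent τ (s₁ τ k) - (c - d) • g = 0 := by
    rw [eq_sub_of_add_eq hU₁.symm, hc]
    module
  simp only [Prod.smul_mk, Prod.mk_sub_mk, hfst, smul_zero, sub_zero] at hmem
  refine hne ((hs₂ τ k).1.eq_of_exponent_add hq₂ hA hB (hcountA.trans (hs₂ τ k).2.symm)
    (hcountB.trans (hs₂ τ k).2.symm) ?_)
  rw [hU₂, ← sub_eq_zero]
  exact eq_zero_of_zero_prod_mem_span hindep hmem

theorem notMem_pairSpan_of_complementary {q₂ : Phase n} (hq₂ : IsGeneric q₂)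
    (hs₂ : IsSelection s₂ q₂) (hindep : LinearIndependent ℝ (vec s₁)) {τ : Kind}
    {k : Fin (n / 2 + 1)} {C : ZMod n → Cell} (hC : IsConfig C)
    (hcount : numFactors C + 2 * (k : ℕ) = n)
    (hsum : exponent τ (s₁ τ k) + exponent τ (s₂ τ k) = total τ + exponent τ.swap C) :
    (g, 0) ∉ pairSpan s₁ s₂ := by
  obtain ⟨j, hj⟩ := hC.exists_index
  obtain ⟨A, B, hA, hB, hne, hcountA, hcountB, hAB⟩ :=
    exists_factorization τ (h.right τ.swap j).1.1 (k := (k : ℕ))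
      (by rw [(h.right τ.swap j).2, ← hj, hcount])
  have hdot : dot (exponent τ.swap (s₁ τ.swap j)) q₀ ≤ dot (exponent τ.swap C) q₀ := by
    have hdotAB := congrArg (fun v => dot v q₀) hAB
    have hdotC := congrArg (fun v => dot v q₀) hsum
    simp only [map_add, LinearMap.add_apply] at hdotAB hdotC
    linarith [h.left.dot_le τ k hA hcountA, h.left.dot_le τ k hB hcountB,
      h.left.dot_eq h.right τ k, h.left.dot_eq h.right τ.swap j]
  obtain ⟨d, hd⟩ := h.isWall.exists_exponent_eq h.left hC hj hdot
  exact h.notMem_pairSpan_of_product hq₂ hs₂ hindep hA hB hne hcountA hcountB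
    ((pairSpan s₁ s₂).add_mem (total_mem_pairSpan s₁ s₂ τ) (h.exponent_mem_pairSpan τ.swap j))
    hAB (by rw [hsum, hd, ← add_assoc])

theorem notMem_pairSpan_of_neighbours {q₂ : Phase n} (hq₂ : IsGeneric q₂)
    (hs₂ : IsSelection s₂ q₂) (hindep : LinearIndependent ℝ (vec s₁)) {τ : Kind}
    {k : Fin (n / 2 + 1)} {C D : ZMod n → Cell} (hC : IsConfig C) (hD : IsConfig D)
    (hcountC : numFactors C = (k : ℕ) + 1) (hcountD : numFactors D = (k : ℕ) - 1)
    (hsum : exponent τ C + exponent τ D = exponent τ (s₁ τ k) + exponent τ (s₂ τ k)) :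
    (g, 0) ∉ pairSpan s₁ s₂ := by
  obtain ⟨j, hj⟩ := hC.exists_index
  obtain ⟨j', hj'⟩ := hD.exists_index
  obtain ⟨A, B, hA, hB, hne, hcountA, hcountB, hAB⟩ :=
    exists_rearrangement_of_numFactors_eq_add_two (h.right τ j).1.1 (h.right τ j').1.1
      (by rw [(h.right τ j).2, (h.right τ j').2, ← hj, ← hj']; omega)
  have hk : numFactors (s₂ τ j') + 1 = (k : ℕ) := by rw [(h.right τ j').2, ← hj']; omega
  rw [hk] at hcountA hcountB
  have hdotAB := congrArg (fun v => dot v q₀) (hAB τ)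
  have hdotCD := congrArg (fun v => dot v q₀) hsum
  simp only [map_add, LinearMap.add_apply] at hdotAB hdotCD
  have hleA := h.left.dot_le τ k hA hcountA
  have hleB := h.left.dot_le τ k hB hcountB
  have heq := h.left.dot_eq h.right τ
  obtain ⟨d, hd⟩ := h.isWall.exists_exponent_eq (τ := τ) h.left hC hj
    (by linarith [heq k, heq j, heq j', h.left.dot_le τ j' hD hj'])
  obtain ⟨d', hd'⟩ := h.isWall.exists_exponent_eq (τ := τ) h.left hD hj'
    (by linarith [heq k, heq j, heq j', h.left.dot_le τ j hC hj])
  refine h.notMem_pairSpan_of_product hq₂ hs₂ hindep hA hB hne hcountA hcountB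
    ((pairSpan s₁ s₂).add_mem (h.exponent_mem_pairSpan τ j) (h.exponent_mem_pairSpan τ j'))
    (hAB τ) (d := d + d') ?_
  rw [← hsum, hd, hd', add_smul]
  abel

theorem notMem_pairSpan_of_bracket_ne_zero {q₁ : Phase n} (hq₁ : IsGeneric q₁)
    (hs₁ : IsSelection s₁ q₁) {τ : Kind} {k : Fin (n / 2 + 1)} {C D : ZMod n → Cell}
    (hC : IsConfig C) (hD : IsConfig D) (hcountC : numFactors C = (k : ℕ))
    (hcountD : numFactors D = (k : ℕ)) (hne : C ≠ s₁ τ k)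
    (hsum : exponent τ C + exponent τ D = exponent τ (s₁ τ k) + exponent τ (s₂ τ k))
    (hbracket : ∀ c : ℝ,
      exponent τ (s₂ τ k) - exponent τ (s₁ τ k) = c • (exponent τ C - exponent τ (s₁ τ k)) →
        bracket (exponent τ (s₁ τ k)) (exponent τ (s₂ τ k)) ≠ 0) :
    (g, 0) ∉ pairSpan s₁ s₂ := by
  intro hg
  obtain ⟨c, hc⟩ := h.exists_exponent_eq τ k
  have hdotCD := congrArg (fun v => dot v q₀) hsum
  simp only [map_add, LinearMap.add_apply] at hdotCD
  obtain ⟨d, hd⟩ := h.isWall.exists_exponent_eq (τ := τ) h.left hC hcountC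
    (by linarith [h.left.dot_le τ k hD hcountD, h.left.dot_eq h.right τ k])
  have hd_ne : d ≠ 0 := by
    rintro rfl
    rw [zero_smul, add_zero] at hd
    exact hne (exponent_injective τ hC (h.left τ k).1.1 hd)
  have hker : pairSpan s₁ s₂ ≤
      LinearMap.ker ((bracket (exponent τ (s₁ τ k))).comp (LinearMap.fst ℝ _ _)) := by
    rw [pairSpan, Submodule.span_le]
    rintro _ ⟨i, rfl⟩
    exact hq₁.bracket_vec hs₁ (hs₁ τ k).1 i
  have hzero : bracket (exponent τ (s₁ τ k)) g = 0 := hker hg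
  refine hbracket (c / d) ?_ ?_
  · rw [hd, hc, add_sub_cancel_left, add_sub_cancel_left, smul_smul, div_mul_cancel₀ _ hd_ne]
  · rw [hc, map_add, map_smul, bracket_self, hzero, smul_zero, add_zero]

theorem linearIndependent_vec {q₁ q₂ : Phase n} (hq₁ : IsGeneric q₁) (hq₂ : IsGeneric q₂)
    (hs₁ : IsSelection s₁ q₁) (hs₂ : IsSelection s₂ q₂)
    (hindep : LinearIndependent ℝ (vec s₁)) : LinearIndependent ℝ (vec s₂) := by
  choose c hc using h.exists_vec_eq
  by_cases heq : s₁ = s₂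
  · rwa [← heq]
  obtain ⟨τ, k, hne⟩ : ∃ τ k, s₁ τ k ≠ s₂ τ k := by
    by_contra! hall
    exact heq (funext₂ hall)
  refine linearIndependent_of_prod_notMem_span hindep hc ?_
  have hrearr := exists_rearrangement τ (hs₁ τ k).1.1 (hs₂ τ k).1.1 (hs₁.numFactors_eq hs₂ τ k) hne
  rw [(hs₁ τ k).2] at hrearr
  obtain ⟨C, hC, hcount, hsum⟩ | ⟨C, D, hC, hD, hcountC, hcountD, hsum⟩ |
    ⟨C, D, hC, hD, hcountC, hcountD, hCne, hsum, hbracket⟩ := hrearr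
  · exact h.notMem_pairSpan_of_complementary hq₂ hs₂ hindep hC hcount hsum
  · exact h.notMem_pairSpan_of_neighbours hq₂ hs₂ hindep hC hD hcountC hcountD hsum
  · exact h.notMem_pairSpan_of_bracket_ne_zero hq₁ hs₁ hC hD hcountC hcountD hCne hsum hbracket

end IsCrossing

/-! ### A base point with independent vectors -/

/-- Weights that favour the sites `0, 2, 4, …` in this order. -/
noncomputable def baseWeight (i : ZMod n) : ℝ :=
  if i.val % 2 = 0 ∧ i.val < 2 * (n / 2) then -(i.val / 2 : ℕ) - 1 else -n

/-- The point all of whose coordinates are the favouring weights. -/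
noncomputable def basePoint (n : ℕ) [NeZero n] : Phase n := (baseWeight, baseWeight)

theorem baseWeight_le (i : ZMod n) : baseWeight i ≤ -1 := by
  have hn : (1 : ℝ) ≤ n := by exact_mod_cast NeZero.one_le
  unfold baseWeight
  split_ifs
  · linarith [Nat.cast_nonneg (α := ℝ) (i.val / 2)]
  · linarith

omit [NeZero n] in
theorem neg_le_baseWeight {k : ℕ} (hk : k ≤ n / 2) {i : ZMod n}
    (hi : i.val % 2 = 0 ∧ i.val < 2 * k) : -(k : ℝ) ≤ baseWeight i := by
  have hval : ((i.val / 2 : ℕ) : ℝ) + 1 ≤ k := by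
    exact_mod_cast (by omega : i.val / 2 + 1 ≤ k)
  rw [baseWeight, if_pos ⟨hi.1, by omega⟩]
  linarith

theorem baseWeight_le_neg {k : ℕ} (hk : k ≤ n / 2) {i : ZMod n}
    (hi : ¬(i.val % 2 = 0 ∧ i.val < 2 * k)) : baseWeight i ≤ -(k : ℝ) - 1 := by
  unfold baseWeight
  split_ifs with hfav
  · have hval : (k : ℝ) ≤ (i.val / 2 : ℕ) := by exact_mod_cast (by omega : k ≤ i.val / 2)
    linarith
  · have hval : (k : ℝ) + 1 ≤ n := by
      have := NeZero.one_le (n := n)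
      exact_mod_cast (by omega : k + 1 ≤ n)
    linarith

/-- The contribution of the state `a` of the site `i` to the value of a monomial at the base point,
where a multiplier `k + 1 / 2` rewards each factor. The multiplier is chosen such that the sites
of `evens k` are those where a short factor pays. -/
noncomputable def siteValue (k : ℕ) (τ : Kind) (i : ZMod n) (a : Cell) : ℝ :=
  startInd a * (k + 1 / 2) + (expX τ a + expY τ a) * baseWeight i

theorem sum_siteValue {k : ℕ} (τ : Kind) {S : ZMod n → Cell} (hS : numFactors S = k) :
    ∑ i, siteValue k τ i (S i) = k * (k + 1 / 2) + dot (exponent τ S) (basePoint n) := by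
  have hcount : ∑ i, (startInd (S i) : ℝ) = k := by
    rw [numFactors] at hS
    exact_mod_cast hS
  simp only [siteValue, Finset.sum_add_distrib, ← Finset.sum_mul, hcount, dot_apply, exponent,
    basePoint, add_mul]

theorem siteValue_le_evens {k : ℕ} (hk : k ≤ n / 2) (τ : Kind) (i : ZMod n) (a : Cell) :
    siteValue k τ i a ≤ siteValue k τ i (evens k i) := by
  have hle := baseWeight_le i
  by_cases hi : i.val % 2 = 0 ∧ i.val < 2 * k
  · have := neg_le_baseWeight hk hi
    cases τ <;> cases a <;>
      simp [siteValue, evens, hi, startInd, expX, expY, occInd, headInd, tailInd] <;> linarith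
  · have := baseWeight_le_neg hk hi
    cases τ <;> cases a <;>
      simp [siteValue, evens, hi, startInd, expX, expY, occInd, headInd, tailInd] <;> linarith

theorem eq_evens_or_eq_head_of_siteValue_eq {k : ℕ} (hk : k ≤ n / 2) {τ : Kind} {i : ZMod n}
    {a : Cell} (h : siteValue k τ i a = siteValue k τ i (evens k i)) :
    a = evens k i ∨ a = head := by
  have hle := baseWeight_le i
  by_cases hi : i.val % 2 = 0 ∧ i.val < 2 * k
  · have := neg_le_baseWeight hk hi
    cases τ <;> cases a <;>
      simp [siteValue, evens, hi, startInd, expX, expY, occInd, headInd, tailInd] at h ⊢ <;>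
      linarith
  · have := baseWeight_le_neg hk hi
    cases τ <;> cases a <;>
      simp [siteValue, evens, hi, startInd, expX, expY, occInd, headInd, tailInd] at h ⊢ <;>
      linarith

omit [NeZero n] in
theorem evens_eq_short_or_eq_empty (k : ℕ) (i : ZMod n) :
    evens k i = short ∨ evens k i = empty := by
  unfold evens
  split_ifs <;> simp

theorem IsOptimal.eq_evens {τ : Kind} {S : ZMod n → Cell} (hS : IsOptimal τ S (basePoint n))
    {k : ℕ} (hk : k ≤ n / 2) (hcount : numFactors S = k) : S = evens k := by
  have hopt := hS.2 (evens k) (isConfig_evens hk) (by rw [numFactors_evens hk, hcount])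
  have hle (i : ZMod n) (_ : i ∈ Finset.univ) := siteValue_le_evens hk τ i (S i)
  have hsum : ∑ i, siteValue k τ i (S i) = ∑ i : ZMod n, siteValue k τ i (evens k i) := by
    refine (Finset.sum_le_sum hle).antisymm ?_
    rw [sum_siteValue τ hcount, sum_siteValue τ (numFactors_evens hk)]
    linarith
  have hsite (i : ZMod n) : S i = evens k i ∨ S i = head := eq_evens_or_eq_head_of_siteValue_eq hk
    ((Finset.sum_eq_sum_iff_of_le hle).1 hsum i (Finset.mem_univ i))
  funext i
  refine (hsite i).resolve_right fun hhead => ?_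
  have htail : S (i + 1) = tail := (hS.1 i).eq_tail_iff.2 hhead
  rcases hsite (i + 1) with h | h
  · rcases evens_eq_short_or_eq_empty k (i + 1) with h' | h' <;> simp [htail, h'] at h
  · simp [htail] at h

/-- The common first or second component of the vectors of the selection of all `evens k`. -/
def evensProfile (k : Fin (n / 2 + 1)) (i : ZMod n) : ℝ :=
  if k = 0 then 1 else occInd (evens (k : ℕ) i)

omit [NeZero n] in
theorem vec_evens {s : Selection n} (hs : ∀ τ k, s τ k = evens (k : ℕ)) (k : Fin (n / 2 + 1)) :
    vec s (.O, k) = (evensProfile k, 0) ∧ vec s (.E, k) = (0, evensProfile k) := by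
  constructor <;> ext i <;> by_cases hk : k = 0 <;>
    rcases evens_eq_short_or_eq_empty (k : ℕ) i with h | h <;>
    simp [vec, evensProfile, total, exponent, expX, expY, occInd, headInd, tailInd, hs, hk, h]

omit [NeZero n] in
theorem sum_ite_lt_eq_zero {a : Fin (n / 2 + 1) → ℝ}
    (ha : ∑ k, a k • evensProfile (n := n) k = 0) (hzero : a 0 = 0) (j : ℕ) :
    ∑ k : Fin (n / 2 + 1), (if j < k then a k else 0) = 0 := by
  by_cases hj : j < n / 2
  · have hval : ((2 * j : ℕ) : ZMod n).val = 2 * j := ZMod.val_natCast_of_lt (by omega)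
    refine Eq.trans (Finset.sum_congr rfl fun k _ => ?_)
      ((Finset.sum_apply _ _ _).symm.trans (congrFun ha ((2 * j : ℕ) : ZMod n)))
    simp only [Pi.smul_apply, evensProfile, evens, hval]
    by_cases hk : k = 0
    · simp [hk, hzero]
    · by_cases hjk : j < k <;> simp [hk, hjk, occInd]
  · exact Finset.sum_eq_zero fun k _ => if_neg (by omega)

omit [NeZero n] in
theorem linearIndependent_evensProfile (hn : 3 ≤ n) :
    LinearIndependent ℝ (evensProfile (n := n)) := by
  rw [Fintype.linearIndependent_iff]
  intro a ha
  have hzero : a 0 = 0 := by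
    have hval : ((1 : ℕ) : ZMod n).val = 1 := ZMod.val_natCast_of_lt (by omega)
    have h := congrFun ha ((1 : ℕ) : ZMod n)
    simp only [Finset.sum_apply, Pi.smul_apply, evensProfile, evens, hval] at h
    simpa [occInd] using h
  intro k
  by_cases hk : k = 0
  · rw [hk, hzero]
  have hk' : (k : ℕ) ≠ 0 := fun h => hk (Fin.ext h)
  have hdiff : (∑ j : Fin (n / 2 + 1), if j = k then a j else 0) =
      (∑ j : Fin (n / 2 + 1), if (k : ℕ) - 1 < j then a j else 0) -
        ∑ j : Fin (n / 2 + 1), if (k : ℕ) < j then a j else 0 := by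
    rw [← Finset.sum_sub_distrib]
    refine Finset.sum_congr rfl fun j _ => ?_
    have : j = k ↔ (j : ℕ) = k := Fin.ext_iff
    split_ifs <;> first | omega | simp
  rw [sum_ite_lt_eq_zero ha hzero, sum_ite_lt_eq_zero ha hzero, sub_zero] at hdiff
  simpa using hdiff

omit [NeZero n] in
theorem linearIndependent_vec_evens (hn : 3 ≤ n) {s : Selection n}
    (hs : ∀ τ k, s τ k = evens (k : ℕ)) : LinearIndependent ℝ (vec s) := by
  rw [Fintype.linearIndependent_iff]
  intro a ha
  have hprofile := Fintype.linearIndependent_iff.1 (linearIndependent_evensProfile hn)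
  rw [Fintype.sum_prod_type, show (Finset.univ : Finset Kind) = {.O, .E} from rfl,
    Finset.sum_pair (by decide)] at ha
  simp only [(vec_evens hs _).1, (vec_evens hs _).2] at ha
  rintro ⟨_ | _, k⟩
  · refine hprofile (fun k => a (.O, k)) ?_ k
    simpa [Prod.fst_sum] using congrArg Prod.fst ha
  · refine hprofile (fun k => a (.E, k)) ?_ k
    simpa [Prod.snd_sum] using congrArg Prod.snd ha

/-! ### Independence at all points off a finite family of hyperplanes -/

open Filter Topology

theorem dot_self_ne_zero {v : Phase n} (hv : v ≠ 0) : dot v v ≠ 0 := by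
  contrapose! hv
  rw [dot_apply, Finset.sum_eq_zero_iff_of_nonneg fun i _ =>
    add_nonneg (mul_self_nonneg _) (mul_self_nonneg _)] at hv
  have hcoord (i) := (add_eq_zero_iff_of_nonneg (mul_self_nonneg _) (mul_self_nonneg _)).1
    (hv i (Finset.mem_univ i))
  ext i
  · exact mul_self_eq_zero.1 (hcoord i).1
  · exact mul_self_eq_zero.1 (hcoord i).2

theorem continuous_dot (f : Phase n) : Continuous (dot f) :=
  LinearMap.continuous_of_finiteDimensional _

theorem dense_dot_ne_zero {f : Phase n} (hf : f ≠ 0) : Dense {q | dot f q ≠ 0} := by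
  have hempty : interior {q | dot f q = 0} = ∅ := by
    by_contra hne
    have htop : LinearMap.ker (dot f) = ⊤ :=
      Submodule.eq_top_of_nonempty_interior' _ (Set.nonempty_iff_ne_empty.2 hne)
    exact dot_self_ne_zero hf (LinearMap.mem_ker.1 (htop ▸ Submodule.mem_top))
  exact interior_eq_empty_iff_dense_compl.1 hempty

theorem dense_forall_dot_ne_zero {Z : Set (Phase n)} (hZ : Z.Finite) (hne : ∀ f ∈ Z, f ≠ 0) :
    Dense {q | ∀ f ∈ Z, dot f q ≠ 0} := by
  have hdense := dense_biInter_of_isOpen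
    (fun f _ => isOpen_ne_fun (continuous_dot f) continuous_const) hZ.countable
    fun f hf => dense_dot_ne_zero (hne f hf)
  refine hdense.mono fun q hq f hf => ?_
  exact Set.mem_iInter₂.1 hq f hf

theorem eventually_isNear (p : Phase n) : ∀ᶠ q in 𝓝 p, IsNear p q := by
  refine finite_exponentDiffs.eventually_all.2 fun f _ => ?_
  by_cases hpos : 0 < dot f p
  · filter_upwards [(continuous_dot f).continuousAt.eventually (lt_mem_nhds hpos)] with q hq _
    using hq
  · exact .of_forall fun q h => absurd h hpos

theorem exists_isNear_forall_dot_ne_zero {Z : Set (Phase n)} (hZ : Z.Finite)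
    (hne : ∀ f ∈ Z, f ≠ 0) (p : Phase n) : ∃ q, IsNear p q ∧ ∀ f ∈ Z, dot f q ≠ 0 :=
  have hfrequently := mem_closure_iff_frequently.1 (dense_forall_dot_ne_zero hZ hne p)
  (hfrequently.and_eventually (eventually_isNear p)).exists.imp fun _ => And.symm

/-- The linear functions with which the invariants agree at `q` are independent. -/
def IsIndep (q : Phase n) : Prop := ∀ s : Selection n, IsSelection s q → LinearIndependent ℝ (vec s)

theorem isGeneric_iff_forall_mem_diff {q : Phase n} :
    IsGeneric q ↔ ∀ f ∈ exponentDiffs n \ {0}, dot f q ≠ 0 := by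
  simp [isGeneric_iff]

theorem exists_isGeneric_isIndep (hn : 3 ≤ n) : ∃ b : Phase n, IsGeneric b ∧ IsIndep b := by
  obtain ⟨b, hnear, hgeneric⟩ := exists_isNear_forall_dot_ne_zero
    (finite_exponentDiffs.subset Set.sdiff_subset) (fun f hf => hf.2) (basePoint n)
  refine ⟨b, isGeneric_iff_forall_mem_diff.2 hgeneric, fun s hs => ?_⟩
  refine linearIndependent_vec_evens hn fun τ k => ?_
  obtain ⟨hopt, hcount⟩ := hs.of_isNear hnear τ k
  exact hopt.eq_evens (Nat.lt_succ_iff.1 k.2) hcount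

theorem IsIndep.of_isWall {g q₀ q₁ q₂ : Phase n} (hindep : IsIndep q₁) (hwall : IsWall g q₀)
    (hnear₁ : IsNear q₀ q₁) (hnear₂ : IsNear q₀ q₂) (hq₁ : IsGeneric q₁) (hq₂ : IsGeneric q₂) :
    IsIndep q₂ := by
  intro s₂ hs₂
  obtain ⟨s₁, hs₁⟩ := exists_isSelection q₁
  have hcross : IsCrossing g q₀ s₁ s₂ := ⟨hwall, hs₁.of_isNear hnear₁, hs₂.of_isNear hnear₂⟩
  exact hcross.linearIndependent_vec hq₁ hq₂ hs₁ hs₂ (hindep s₁ hs₁)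

/-- The line through `b` and `q` meets different walls at different points. -/
def MeetsWallsSeparately (b q : Phase n) : Prop :=
  ∀ f ∈ exponentDiffs n, ∀ f' ∈ exponentDiffs n, dot f b • f' - dot f' b • f ≠ 0 →
    dot (dot f b • f' - dot f' b • f) q ≠ 0

theorem dot_lineMap (f b q : Phase n) (t : ℝ) :
    dot f (AffineMap.lineMap b q t) = dot f b + t * (dot f q - dot f b) := by
  rw [AffineMap.lineMap_apply_module', map_add, map_smul, map_sub, smul_eq_mul, add_comm]

theorem MeetsWallsSeparately.exists_isWall {b q : Phase n} (h : MeetsWallsSeparately b q)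
    (hb : IsGeneric b) (t : ℝ) : ∃ g, IsWall g (AffineMap.lineMap b q t) := by
  by_cases hvanish : ∀ f ∈ exponentDiffs n, dot f (AffineMap.lineMap b q t) = 0 → f = 0
  · exact ⟨0, fun f hf hdot => ⟨0, by rw [hvanish f hf hdot, smul_zero]⟩⟩
  push Not at hvanish
  obtain ⟨g, hg, hdotg, hg_ne⟩ := hvanish
  have hgb : dot g b ≠ 0 := isGeneric_iff.1 hb g hg hg_ne
  have ht : t ≠ 0 := by
    rintro rfl
    exact hgb (by simpa using hdotg)
  refine ⟨g, fun f hf hdotf => ⟨dot f b / dot g b, ?_⟩⟩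
  rw [dot_lineMap] at hdotf hdotg
  have hzero : dot g b • f - dot f b • g = 0 := by
    by_contra hne
    refine h g hg f hf hne ?_
    simp only [map_sub, map_smul, LinearMap.sub_apply, LinearMap.smul_apply, smul_eq_mul]
    refine (mul_eq_zero.1 (?_ : t * _ = 0)).resolve_left ht
    linear_combination dot g b * hdotf - dot f b * hdotg
  rw [div_eq_inv_mul, mul_smul, ← sub_eq_zero.1 hzero, inv_smul_smul₀ hgb]

theorem dense_isGeneric_lineMap {b : Phase n} (hb : IsGeneric b) (q : Phase n) :
    Dense {t : ℝ | IsGeneric (AffineMap.lineMap b q t)} := by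
  have hfinite : {t : ℝ | ¬IsGeneric (AffineMap.lineMap b q t)}.Finite := by
    have hdiff : (exponentDiffs n \ {0}).Finite := finite_exponentDiffs.subset Set.sdiff_subset
    refine (hdiff.biUnion (t := fun f => {t : ℝ | dot f (AffineMap.lineMap b q t) = 0})
      fun f hf => Set.Subsingleton.finite fun t ht t' ht' => ?_).subset fun t ht => ?_
    · have hfb := isGeneric_iff_forall_mem_diff.1 hb f hf
      simp only [Set.mem_ofPred_eq, dot_lineMap] at ht ht'
      have hslope : dot f q - dot f b ≠ 0 := fun h => hfb (by simpa [h] using ht)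
      exact mul_right_cancel₀ hslope (by linarith)
    · simpa [isGeneric_iff_forall_mem_diff, and_assoc] using ht
  simpa [Set.compl_ofPred] using hfinite.countable.dense_compl ℝ

/-- Independence propagates along the line from a generic point `b`: whether the vectors are
independent at the generic points near a given point of the line does not depend on the side. -/
theorem MeetsWallsSeparately.isIndep {b q : Phase n} (h : MeetsWallsSeparately b q)
    (hb : IsGeneric b) (hindep : IsIndep b) (hq : IsGeneric q) : IsIndep q := by
  let p : ℝ → Phase n := AffineMap.lineMap b q
  have hcont : Continuous p := AffineMap.lineMap_continuous
  have hnear (t) : ∀ᶠ r in 𝓝 t, IsNear (p t) (p r) := hcont.continuousAt.eventually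
    (eventually_isNear _)
  let A : Set ℝ := {t | ∀ᶠ r in 𝓝 t, IsGeneric (p r) → IsIndep (p r)}
  have hpropagate {t r : ℝ} (hr : IsNear (p t) (p r)) (hgen : IsGeneric (p r))
      (hindep_r : IsIndep (p r)) : t ∈ A := by
    obtain ⟨g, hg⟩ := h.exists_isWall hb t
    filter_upwards [hnear t] with r' hr' hgen'
    exact hindep_r.of_isWall hg hr hr' hgen hgen'
  have hopen : IsOpen A := isOpen_setOfPred_eventually_nhds
  have hclosed : IsClosed A := by
    refine isClosed_of_closure_subset fun t ht => ?_
    obtain ⟨t', ht', hnear'⟩ := ((mem_closure_iff_frequently.1 ht).and_eventually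
      (eventually_eventually_nhds.2 (hnear t))).exists
    obtain ⟨r, hgen, hr, hindep_r⟩ := ((mem_closure_iff_frequently.1
      (dense_isGeneric_lineMap hb q t')).and_eventually (hnear'.and ht')).exists
    exact hpropagate hr hgen (hindep_r hgen)
  have hzero : (0 : ℝ) ∈ A :=
    hpropagate (r := 0) (fun _ _ h => h) (by simpa [p] using hb) (by simpa [p] using hindep)
  have hone : (1 : ℝ) ∈ A := by
    rw [IsClopen.eq_univ ⟨hclosed, hopen⟩ ⟨0, hzero⟩]
    exact Set.mem_univ 1
  simpa [p, hq] using hone.self_of_nhds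

theorem exists_finite_isGeneric_isIndep (hn : 3 ≤ n) : ∃ Z : Set (Phase n), Z.Finite ∧
    (∀ f ∈ Z, f ≠ 0) ∧ ∀ q, (∀ f ∈ Z, dot f q ≠ 0) → IsGeneric q ∧ IsIndep q := by
  obtain ⟨b, hb, hindep⟩ := exists_isGeneric_isIndep hn
  have hpairs := (finite_exponentDiffs (n := n)).prod (finite_exponentDiffs (n := n))
  refine ⟨(exponentDiffs n ∪ (fun x : Phase n × Phase n => dot x.1 b • x.2 - dot x.2 b • x.1) ''
    (exponentDiffs n ×ˢ exponentDiffs n)) \ {0},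
    (finite_exponentDiffs.union (hpairs.image _)).subset Set.sdiff_subset,
    fun f hf => hf.2, fun q hq => ?_⟩
  have hgeneric : IsGeneric q :=
    isGeneric_iff_forall_mem_diff.2 fun f hf => hq f ⟨.inl hf.1, hf.2⟩
  have hwalls : MeetsWallsSeparately b q :=
    fun f hf f' hf' hne => hq _ ⟨.inr ⟨(f, f'), ⟨hf, hf'⟩, rfl⟩, hne⟩
  exact ⟨hgeneric, hwalls.isIndep hb hindep hgeneric⟩

/-! ### Polyhedra -/

section Polyhedron

theorem eventually_pos_add_mul {r s : ℝ} (hr : 0 ≤ r) (hs : r = 0 → 0 < s) :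
    ∀ᶠ t in 𝓝[>] (0 : ℝ), 0 < r + t * s := by
  rcases hr.eq_or_lt with rfl | hr
  · filter_upwards [self_mem_nhdsWithin] with t ht
    simpa using mul_pos ht (hs rfl)
  · have hcont : ContinuousAt (fun t : ℝ => r + t * s) 0 := by fun_prop
    exact nhdsWithin_le_nhds (hcont.eventually (lt_mem_nhds (by simpa using hr)))

variable {V W J : Type*} [AddCommGroup V] [Module ℝ V] [AddCommGroup W] [Module ℝ W]

/-- The polyhedron of the solutions of the inequalities `0 ≤ a j` on a fibre of `L`. -/
def polyhedron (a : J → V →ₗ[ℝ] ℝ) (L : V →ₗ[ℝ] W) (c : W) : Set V :=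
  {p | (∀ j, 0 ≤ a j p) ∧ L p = c}

variable {a : J → V →ₗ[ℝ] ℝ} {L : V →ₗ[ℝ] W} {c : W}

theorem convex_polyhedron : Convex ℝ (polyhedron a L c) := by
  have hineq : Convex ℝ {p | ∀ j, 0 ≤ a j p} := by
    rw [Set.ofPred_forall]
    exact convex_iInter fun j => convex_halfSpace_ge (a j).isLinear 0
  exact hineq.inter ((convex_singleton c).linear_preimage L)

theorem eventually_add_smul_mem_polyhedron [Finite J] {x v : V} (hx : x ∈ polyhedron a L c)
    (hv : L v = 0) (ha : ∀ j, a j x = 0 → 0 ≤ a j v) :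
    ∀ᶠ t in 𝓝[>] (0 : ℝ), x + t • v ∈ polyhedron a L c := by
  have hineq : ∀ᶠ t in 𝓝[>] (0 : ℝ), ∀ j, 0 ≤ a j (x + t • v) := by
    refine eventually_all.2 fun j => ?_
    simp only [map_add, map_smul, smul_eq_mul]
    by_cases hj : a j x = 0
    · filter_upwards [self_mem_nhdsWithin] with t ht
      simpa [hj] using mul_nonneg (le_of_lt ht) (ha j hj)
    · exact (eventually_pos_add_mul (hx.1 j) (absurd · hj)).mono fun t ht => ht.le
  filter_upwards [hineq] with t ht
  exact ⟨ht, by rw [map_add, map_smul, hv, smul_zero, add_zero, hx.2]⟩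

theorem exists_mem_polyhedron_forall_pos [Finite J] {x v : V} (hx : x ∈ polyhedron a L c)
    (hv : L v = 0) (ha : ∀ j, a j x = 0 → a j = 0 ∨ 0 < a j v) :
    ∃ y ∈ polyhedron a L c, ∀ j, a j = 0 ∨ 0 < a j y := by
  have hmem := eventually_add_smul_mem_polyhedron hx hv fun j hj =>
    (ha j hj).elim (fun h => by simp [h]) le_of_lt
  have hpos : ∀ᶠ t in 𝓝[>] (0 : ℝ), ∀ j, a j = 0 ∨ 0 < a j (x + t • v) := by
    refine eventually_all.2 fun j => ?_
    by_cases hj : a j = 0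
    · exact .of_forall fun t => .inl hj
    · filter_upwards [eventually_pos_add_mul (hx.1 j) fun h => (ha j h).resolve_left hj] with t ht
      simpa using .inr ht
  obtain ⟨t, ht, ht'⟩ := (hmem.and hpos).exists
  exact ⟨x + t • v, ht, ht'⟩

theorem finite_extremePoints_polyhedron [Finite J] :
    ((polyhedron a L c).extremePoints ℝ).Finite := by
  -- An extreme point is determined by its set of active inequalities.
  refine Set.Finite.of_finite_image (f := fun x => {j | a j x = 0}) (Set.toFinite _)
    fun x hx y hy hactive => ?_
  have hzero (j) (hj : a j x = 0) : a j (y - x) = 0 := by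
    have hj' : a j y = 0 := (Set.ext_iff.1 hactive j).1 hj
    rw [map_sub, hj, hj', sub_zero]
  have hL : L (y - x) = 0 := by rw [map_sub, hx.1.2, hy.1.2, sub_self]
  have hforth := eventually_add_smul_mem_polyhedron hx.1 hL fun j hj => (hzero j hj).ge
  have hback := eventually_add_smul_mem_polyhedron (v := -(y - x)) hx.1
    (by rw [map_neg, hL, neg_zero]) fun j hj => by rw [map_neg, hzero j hj, neg_zero]
  obtain ⟨t, ⟨hmem, hmem'⟩, ht⟩ := ((hforth.and hback).and self_mem_nhdsWithin).exists
  have hmid : x ∈ openSegment ℝ (x + t • (y - x)) (x + t • -(y - x)) :=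
    ⟨1 / 2, 1 / 2, by norm_num, by norm_num, by norm_num, by module⟩
  have hsmul : t • (y - x) = 0 := by simpa using hx.2 hmem hmem' hmid
  exact (sub_eq_zero.1 ((smul_eq_zero_iff_right (ne_of_gt ht)).1 hsmul)).symm

theorem vectorSpan_polyhedron [Finite J] {x : V} (hx : x ∈ polyhedron a L c)
    (hpos : ∀ j, a j = 0 ∨ 0 < a j x) : vectorSpan ℝ (polyhedron a L c) = LinearMap.ker L := by
  refine le_antisymm (Submodule.span_le.2 ?_) fun v hv => ?_
  · rintro _ ⟨p, hp, p', hp', rfl⟩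
    simp [hp.2, hp'.2]
  · have hmem := eventually_add_smul_mem_polyhedron hx (LinearMap.mem_ker.1 hv) fun j hj =>
      (hpos j).elim (fun h => by simp [h]) fun h => absurd hj h.ne'
    obtain ⟨t, hmem, ht⟩ := (hmem.and self_mem_nhdsWithin).exists
    have hspan := vsub_mem_vectorSpan ℝ hmem hx
    rw [vsub_eq_sub, add_sub_cancel_left] at hspan
    exact (Submodule.smul_mem_iff _ (ne_of_gt ht)).1 hspan

variable [TopologicalSpace V] [IsTopologicalAddGroup V] [ContinuousSMul ℝ V] [T2Space V]

theorem isClosed_polyhedron [FiniteDimensional ℝ V] [TopologicalSpace W] [IsTopologicalAddGroup W]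
    [ContinuousSMul ℝ W] [T1Space W] : IsClosed (polyhedron a L c) := by
  have hineq : IsClosed {p | ∀ j, 0 ≤ a j p} := by
    rw [Set.ofPred_forall]
    exact isClosed_iInter fun j =>
      isClosed_le continuous_const (a j).continuous_of_finiteDimensional
  exact hineq.inter (isClosed_singleton.preimage L.continuous_of_finiteDimensional)

theorem exists_finset_convexHull_eq_polyhedron [LocallyConvexSpace ℝ V] [Finite J]
    (hcompact : IsCompact (polyhedron a L c)) {x : V} (hx : x ∈ polyhedron a L c)
    (hpos : ∀ j, a j = 0 ∨ 0 < a j x) :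
    ∃ s : Finset V, convexHull ℝ (s : Set V) = polyhedron a L c ∧ s.Nonempty ∧
      Module.finrank ℝ (vectorSpan ℝ (s : Set V)) = Module.finrank ℝ (LinearMap.ker L) := by
  have hfin := finite_extremePoints_polyhedron (a := a) (L := L) (c := c)
  have hull : convexHull ℝ (hfin.toFinset : Set V) = polyhedron a L c := by
    rw [hfin.coe_toFinset, ← (hfin.isClosed_convexHull ℝ).closure_eq]
    exact closure_convexHull_extremePoints hcompact convex_polyhedron
  refine ⟨hfin.toFinset, hull, ?_, ?_⟩
  · rw [← Finset.coe_nonempty, ← convexHull_nonempty_iff (𝕜 := ℝ), hull]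
    exact ⟨x, hx⟩
  · rw [← direction_affineSpan, ← affineSpan_convexHull, hull, direction_affineSpan,
      vectorSpan_polyhedron hx hpos]

end Polyhedron

/-! ### Level sets -/

/-- The family `x` or `y` of coordinates. -/
def coord : Kind → Phase n → ZMod n → ℝ
  | .O, p => p.1
  | .E, p => p.2

theorem mem_levelSet_iff_forall_kind {p q : Phase n} : p ∈ levelSet q ↔
    ∀ τ, ∑ i, coord τ p i = ∑ i, coord τ q i ∧
      ∀ k ∈ Finset.Icc 1 (n / 2), trop τ k p = trop τ k q := by
  constructor
  · rintro ⟨hx, hy, htrop⟩ (_ | _)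
    · exact ⟨hx, fun k hk => (htrop k hk).1⟩
    · exact ⟨hy, fun k hk => (htrop k hk).2⟩
  · exact fun h => ⟨(h .O).1, (h .E).1, fun k hk => ⟨(h .O).2 k hk, (h .E).2 k hk⟩⟩

theorem dot_total (τ : Kind) (q : Phase n) : dot (total τ) q = ∑ i, coord τ q i := by
  cases τ <;> simp [dot_apply, total, coord]

/-- The values of the invariants, indexed like `vec`. -/
noncomputable def invariants (q : Phase n) (i : Kind × Fin (n / 2 + 1)) : ℝ :=
  if i.2 = 0 then dot (total i.1) q else trop i.1 (i.2 : ℕ) q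

theorem mem_levelSet_iff {p q : Phase n} : p ∈ levelSet q ↔ invariants p = invariants q := by
  rw [mem_levelSet_iff_forall_kind, funext_iff, Prod.forall]
  refine forall_congr' fun τ => ?_
  rw [Fin.forall_fin_succ]
  simp only [invariants, if_pos, dot_total, Fin.succ_ne_zero, if_false, Fin.val_succ]
  refine and_congr_right' ⟨fun h k => h _ (Finset.mem_Icc.2 ⟨by omega, by omega⟩),
    fun h k hk => ?_⟩
  obtain ⟨hone, hle⟩ := Finset.mem_Icc.1 hk
  simpa [Nat.sub_add_cancel hone] using h ⟨k - 1, by omega⟩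

/-- The configuration with a single short factor. -/
def singleShort (i j : ZMod n) : Cell := if j = i then short else empty

omit [NeZero n] in
theorem isConfig_singleShort (hn : 3 ≤ n) (i : ZMod n) : IsConfig (singleShort i) := by
  intro j
  have := one_ne_zero_zmod hn
  unfold singleShort
  split_ifs <;> simp_all [CanPrecede]

theorem numFactors_singleShort (i : ZMod n) : numFactors (singleShort i) = 1 := by
  simp only [numFactors, singleShort, apply_ite startInd]
  simp [startInd]

theorem dot_exponent_singleShort (τ : Kind) (i : ZMod n) (p : Phase n) :
    dot (exponent τ (singleShort i)) p = coord τ p i := by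
  cases τ <;> simp only [dot_apply, exponent, expX, expY, singleShort, apply_ite occInd,
    apply_ite headInd, apply_ite tailInd] <;> simp [coord, occInd, headInd, tailInd]

theorem coord_le_trop_one (hn : 3 ≤ n) (τ : Kind) (i : ZMod n) (p : Phase n) :
    coord τ p i ≤ trop τ 1 p := by
  obtain ⟨S, hS, hcount⟩ := exists_isOptimal τ p (k := 1) (by omega)
  rw [hS.trop_eq hn hcount, ← dot_exponent_singleShort]
  exact hS.2 _ (isConfig_singleShort hn i) (by rw [numFactors_singleShort, hcount, Nat.cast_one])

theorem sum_sub_le_of_forall_le {g : ZMod n → ℝ} {M : ℝ} (hg : ∀ i, g i ≤ M) (i : ZMod n) :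
    (∑ j, g j) - (n - 1 : ℕ) * M ≤ g i := by
  have hsum := Finset.add_sum_erase Finset.univ g (Finset.mem_univ i)
  have hle := Finset.sum_le_card_nsmul (Finset.univ.erase i) g M fun j _ => hg j
  rw [Finset.card_erase_of_mem (Finset.mem_univ i), Finset.card_univ, ZMod.card,
    nsmul_eq_mul] at hle
  linarith

theorem isBounded_levelSet (hn : 3 ≤ n) (q : Phase n) : Bornology.IsBounded (levelSet q) := by
  let upper (τ : Kind) (_ : ZMod n) : ℝ := trop τ 1 q
  let lower (τ : Kind) (_ : ZMod n) : ℝ := (∑ j, coord τ q j) - (n - 1 : ℕ) * trop τ 1 q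
  refine (isCompact_Icc (a := ((lower .O, lower .E) : Phase n))
    (b := (upper .O, upper .E))).isBounded.subset fun p hp => ?_
  have hp := mem_levelSet_iff_forall_kind.1 hp
  have hupper (τ i) : coord τ p i ≤ trop τ 1 q := by
    rw [← (hp τ).2 1 (Finset.mem_Icc.2 ⟨le_rfl, by omega⟩)]
    exact coord_le_trop_one hn τ i p
  have hlower (τ i) : (∑ j, coord τ q j) - (n - 1 : ℕ) * trop τ 1 q ≤ coord τ p i := by
    rw [← (hp τ).1]
    exact sum_sub_le_of_forall_le (hupper τ) i
  exact ⟨⟨hlower .O, hlower .E⟩, hupper .O, hupper .E⟩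

/-- The linear map with which the invariants agree where the selection `s` is optimal. -/
noncomputable def linearization (s : Selection n) : Phase n →ₗ[ℝ] (Kind × Fin (n / 2 + 1) → ℝ) :=
  LinearMap.pi fun i => dot (vec s i)

theorem IsSelection.linearization_eq (hn : 3 ≤ n) {s : Selection n} {p : Phase n}
    (h : IsSelection s p) : linearization s p = invariants p := by
  funext i
  simp only [linearization, LinearMap.pi_apply, invariants, vec]
  split_ifs
  · rfl
  · exact ((h _ _).1.trop_eq hn (h _ _).2).symm

theorem surjective_linearization {s : Selection n} (hs : LinearIndependent ℝ (vec s)) :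
    Function.Surjective (linearization s) := by
  rw [← LinearMap.dualMap_injective_iff, injective_iff_map_eq_zero]
  intro φ hφ
  have hφ_apply (x) : φ x = ∑ i, φ (Pi.single i 1) * x i := by
    simpa [mul_comm] using congrArg φ ((Pi.basisFun ℝ _).sum_repr x).symm
  have hdot (w) : dot (∑ i, φ (Pi.single i 1) • vec s i) w = φ (linearization s w) := by
    rw [hφ_apply]
    simp [linearization]
  have hsum : ∑ i, φ (Pi.single i 1) • vec s i = 0 := by
    by_contra hne
    exact dot_self_ne_zero hne ((hdot _).trans (LinearMap.congr_fun hφ _))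
  have hzero := Fintype.linearIndependent_iff.1 hs _ hsum
  refine LinearMap.ext fun x => (hφ_apply x).trans (Finset.sum_eq_zero fun i _ => ?_)
  rw [hzero, zero_mul]

theorem finrank_ker_linearization {s : Selection n} (hs : LinearIndependent ℝ (vec s)) :
    Module.finrank ℝ (LinearMap.ker (linearization s)) = 2 * ((n + 1) / 2) - 2 := by
  have h := LinearMap.finrank_range_add_finrank_ker (linearization s)
  rw [LinearMap.range_eq_top.2 (surjective_linearization hs), finrank_top, Module.finrank_prod,
    Module.finrank_fintype_fun_eq_card, Module.finrank_fintype_fun_eq_card, ZMod.card,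
    Fintype.card_prod, Fintype.card_fin, show Fintype.card Kind = 2 from rfl] at h
  omega

/-! ### Cells of a level set -/

/-- A configuration together with the index of the selected configuration it competes with. -/
abbrev Competitor (n : ℕ) : Type := Kind × Fin (n / 2 + 1) × (ZMod n → Cell)

/-- The function whose nonnegativity says that the selected configuration beats the competitor;
it is set to zero for a meaningless competitor. -/
noncomputable def margin (s : Selection n) (c : Competitor n) : Phase n →ₗ[ℝ] ℝ :=
  open Classical in
  if IsConfig c.2.2 ∧ numFactors c.2.2 = numFactors (s c.1 c.2.1) then
    dot (exponent c.1 (s c.1 c.2.1) - exponent c.1 c.2.2) else 0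

theorem IsSelection.iff_margin_nonneg {s : Selection n} {p₀ : Phase n} (h₀ : IsSelection s p₀)
    {p : Phase n} : IsSelection s p ↔ ∀ c, 0 ≤ margin s c p := by
  constructor
  · rintro h ⟨τ, k, S⟩
    unfold margin
    split_ifs with hS
    · exact (isOptimal_iff.1 (h τ k).1).2 S hS.1 hS.2
    · exact le_rfl
  · refine fun h τ k => ⟨isOptimal_iff.2 ⟨(h₀ τ k).1.1, fun S hS hcount => ?_⟩, (h₀ τ k).2⟩
    have hmargin := h (τ, k, S)
    rwa [margin, if_pos ⟨hS, hcount⟩] at hmargin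

theorem IsSelection.margin_eq_zero_or_pos {s : Selection n} {p₀ : Phase n} (h₀ : IsSelection s p₀)
    (hgeneric : IsGeneric p₀) (c : Competitor n) : margin s c = 0 ∨ 0 < margin s c p₀ := by
  refine or_iff_not_imp_left.2 fun hne => (h₀.iff_margin_nonneg.1 h₀ c).lt_of_ne' ?_
  unfold margin at hne ⊢
  split_ifs at hne ⊢ with hS
  · exact isGeneric_iff.1 hgeneric _ (sub_mem_exponentDiffs _ (h₀ _ _).1.1 hS.1 hS.2.symm)
      fun hzero => hne (by rw [hzero, map_zero])
  · exact absurd rfl hne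

/-- The part of the level set of `q` on which the selection `s` is optimal. -/
noncomputable def piece (s : Selection n) (q : Phase n) : Set (Phase n) :=
  polyhedron (margin s) (linearization s) (invariants q)

theorem IsSelection.mem_piece_iff (hn : 3 ≤ n) {s : Selection n} {p₀ : Phase n}
    (h₀ : IsSelection s p₀) {p q : Phase n} :
    p ∈ piece s q ↔ IsSelection s p ∧ p ∈ levelSet q := by
  rw [mem_levelSet_iff, h₀.iff_margin_nonneg]
  refine and_congr_right fun h => ?_
  rw [(h₀.iff_margin_nonneg.2 h).linearization_eq hn]

/-- A selection that is optimal at some generic point and whose linearization has maximal rank. -/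
structure IsNondegenerate (s : Selection n) : Prop where
  exists_isGeneric : ∃ p₀, IsGeneric p₀ ∧ IsSelection s p₀
  linearIndependent : LinearIndependent ℝ (vec s)

theorem exists_isNondegenerate_isSelection (hn : 3 ≤ n) (p : Phase n) :
    ∃ s, IsNondegenerate s ∧ IsSelection s p := by
  obtain ⟨Z, hZ, hne, hgood⟩ := exists_finite_isGeneric_isIndep hn
  obtain ⟨p₀, hnear, hp₀⟩ := exists_isNear_forall_dot_ne_zero hZ hne p
  obtain ⟨hgeneric, hindep⟩ := hgood p₀ hp₀
  obtain ⟨s, hs⟩ := exists_isSelection p₀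
  exact ⟨s, ⟨⟨p₀, hgeneric, hs⟩, hindep s hs⟩, hs.of_isNear hnear⟩

theorem levelSet_eq_iUnion_piece (hn : 3 ≤ n) (q : Phase n) :
    levelSet q = ⋃ s ∈ {s | IsNondegenerate s ∧ (piece s q).Nonempty}, piece s q := by
  ext p
  simp only [Set.mem_iUnion, exists_prop]
  constructor
  · intro hp
    obtain ⟨s, hnondeg, hs⟩ := exists_isNondegenerate_isSelection hn p
    obtain ⟨p₀, -, h₀⟩ := hnondeg.exists_isGeneric
    have hmem := (h₀.mem_piece_iff hn).2 ⟨hs, hp⟩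
    exact ⟨s, ⟨hnondeg, p, hmem⟩, hmem⟩
  · rintro ⟨s, ⟨⟨⟨p₀, -, h₀⟩, -⟩, -⟩, hmem⟩
    exact ((h₀.mem_piece_iff hn).1 hmem).2

/-! ### The exceptional subspaces -/

/-- The points at which the linearization of `s'` takes a value that the linearization of `s` takes
on the subspace where the margins of `s` over the competitors in `T` vanish. -/
noncomputable def exceptional (s s' : Selection n) (T : Set (Competitor n)) :
    Submodule ℝ (Phase n) :=
  ((⨅ c ∈ T, LinearMap.ker (margin s c)).map (linearization s)).comap (linearization s')

theorem mem_exceptional {s s' : Selection n} {T : Set (Competitor n)} {x : Phase n} :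
    x ∈ exceptional s s' T ↔
      ∃ w, (∀ c ∈ T, margin s c w = 0) ∧ linearization s w = linearization s' x := by
  simp [exceptional]

/-- The proper subspaces among the exceptional ones. -/
def properExceptional (n : ℕ) [NeZero n] : Set (Submodule ℝ (Phase n)) :=
  {E | (∃ s s' T, exceptional s s' T = E) ∧ E ≠ ⊤}

theorem finite_properExceptional : (properExceptional n).Finite := by
  refine (Set.finite_range fun x : Selection n × Selection n × Set (Competitor n) =>
    exceptional x.1 x.2.1 x.2.2).subset ?_
  rintro _ ⟨⟨s, s', T, rfl⟩, -⟩
  exact ⟨(s, s', T), rfl⟩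

theorem exists_mem_piece_forall_margin_pos (hn : 3 ≤ n) {q : Phase n}
    (hq : ∀ E ∈ properExceptional n, q ∉ E) {s : Selection n} (hs : IsNondegenerate s)
    {p : Phase n} (hp : p ∈ piece s q) :
    ∃ x ∈ piece s q, ∀ c, margin s c = 0 ∨ 0 < margin s c x := by
  obtain ⟨s', hs', hq'⟩ := exists_isNondegenerate_isSelection hn q
  obtain ⟨p₀, hgeneric, h₀⟩ := hs.exists_isGeneric
  let T := {c | margin s c p = 0}
  have hmem : q ∈ exceptional s s' T :=
    mem_exceptional.2 ⟨p, fun c hc => hc, by rw [hq'.linearization_eq hn, hp.2]⟩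
  have htop : exceptional s s' T = ⊤ := by
    by_contra hne
    exact hq _ ⟨⟨s, s', T, rfl⟩, hne⟩ hmem
  obtain ⟨z, hz⟩ := surjective_linearization hs'.linearIndependent (linearization s p₀)
  obtain ⟨w, hw, hwz⟩ := mem_exceptional.1 (htop ▸ Submodule.mem_top : z ∈ exceptional s s' T)
  -- Moving from `p` in the direction `p₀ - w` makes all vanishing margins positive.
  refine exists_mem_polyhedron_forall_pos (v := p₀ - w) hp ?_ fun c hc => ?_
  · rw [map_sub, hwz, hz, sub_self]
  · rw [map_sub, hw c hc, sub_zero]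
    exact h₀.margin_eq_zero_or_pos hgeneric c

theorem exists_finset_convexHull_eq_piece (hn : 3 ≤ n) {q : Phase n}
    (hq : ∀ E ∈ properExceptional n, q ∉ E) {s : Selection n} (hs : IsNondegenerate s)
    (hne : (piece s q).Nonempty) :
    ∃ F : Finset (Phase n), convexHull ℝ (F : Set (Phase n)) = piece s q ∧ F.Nonempty ∧
      Module.finrank ℝ (vectorSpan ℝ (F : Set (Phase n))) = 2 * ((n + 1) / 2) - 2 := by
  obtain ⟨p₀, -, h₀⟩ := hs.exists_isGeneric
  obtain ⟨p, hp⟩ := hne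
  obtain ⟨x, hx, hpos⟩ := exists_mem_piece_forall_margin_pos hn hq hs hp
  have hbounded : Bornology.IsBounded (piece s q) :=
    (isBounded_levelSet hn q).subset fun y hy => ((h₀.mem_piece_iff hn).1 hy).2
  rw [← finrank_ker_linearization hs.linearIndependent]
  exact exists_finset_convexHull_eq_polyhedron
    (Metric.isCompact_of_isClosed_isBounded isClosed_polyhedron hbounded) hx hpos

theorem isPolytopeOfDim_levelSet (hn : 3 ≤ n) {q : Phase n}
    (hq : ∀ E ∈ properExceptional n, q ∉ E) :
    IsPolytopeOfDim (levelSet q) (2 * ((n + 1) / 2) - 2) := by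
  let I : Set (Selection n) := {s | IsNondegenerate s ∧ (piece s q).Nonempty}
  have hunion : levelSet q = ⋃ s ∈ I, piece s q := levelSet_eq_iUnion_piece hn q
  choose! F hF using fun s (hs : s ∈ I) => exists_finset_convexHull_eq_piece hn hq hs.1 hs.2
  refine ⟨F '' I, Set.toFinite _, ?_, Set.forall_mem_image.2 fun s hs => (hF s hs).2, ?_⟩
  · have hmem : q ∈ ⋃ s ∈ I, piece s q := hunion ▸ mem_levelSet_iff.2 rfl
    obtain ⟨s, hs, -⟩ := Set.mem_iUnion₂.1 hmem
    exact ⟨F s, s, hs, rfl⟩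
  · rw [Set.biUnion_image, hunion]
    exact Set.iUnion₂_congr fun s hs => (hF s hs).1.symm

end Pentagram

theorem theorem2p3 (n : ℕ) [NeZero n] (hn : 3 ≤ n) :
    (∀ (q : Pentagram.Phase n) (l : ℕ),
      Pentagram.automaton^[l] q ∈ Pentagram.levelSet q) ∧
    ∃ H : Set (AffineSubspace ℝ (Pentagram.Phase n)), H.Finite ∧ (∀ A ∈ H, A ≠ ⊤) ∧
      ∀ q : Pentagram.Phase n, (∀ A ∈ H, q ∉ A) →
        Pentagram.IsPolytopeOfDim (Pentagram.levelSet q) (2 * ((n + 1) / 2) - 2) := by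
  refine ⟨fun q l => Pentagram.iterate_automaton_mem_levelSet hn q l,
    Submodule.toAffineSubspace '' Pentagram.properExceptional n,
    Pentagram.finite_properExceptional.image _,
    Set.forall_mem_image.2 fun E hE htop => hE.2 ?_, fun q hq =>
      Pentagram.isPolytopeOfDim_levelSet hn fun E hE => hq _ ⟨E, hE, rfl⟩⟩
  rw [← E.toAffineSubspace_direction, htop, AffineSubspace.direction_top]
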